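/- Let $\varepsilon,\mu:\mathbb R\to(0,\infty)$ be piecewise continuous functions of period one, and let $$\mathcal L\psi=-\frac1{\varepsilon}\Big(\frac{\psi'}{\mu}\Big)'$$ act on the functions $\psi:\mathbb R\to\mathbb C$ for which $\psi$ and $\psi'/\mu$ are locally absolutely continuous. Assume that $\mathcal L$ is inversion symmetric: $\mathcal P\mathcal L=\mathcal L\mathcal P$, where $(\mathcal P\psi)(x)=\psi(-x)$. For $k\in[-\pi,\pi]$ let $E_1(k)\le E_2(k)\le\cdots$ be the eigenvalues, counted with multiplicity, of the problem $\mathcal L u=Eu$ on $[0,1]$, where $u$ and $u'/\mu$ are absolutely continuous on $[0,1]$, $u(1)=e^{ik}u(0)$ and $\frac{u'}{\mu}(1)=e^{ik}\frac{u'}{\mu}(0)$. The eigenfunctions with eigenvalue $E$, extended to $\mathbb R$ by $u(x+1)=e^{ik}u(x)$, are called the Bloch modes at $(k,E)$. Put $$E_j^-=\min_{k\in[-\pi,\pi]}E_j(k),\qquad E_j^+=\max_{k\in[-\pi,\pi]}E_j(k).$$ Let $j\ge1$ and assume that there is a gap between the $j$-th and the $(j+1)$-th band, that is, $E_j^+<E_{j+1}^-$.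 Then there is $k^*\in\{0,\pi\}$ with $E_j(k^*)=E_j^+$ and $E_{j+1}(k^*)=E_{j+1}^-$. Moreover, for every such $k^*$ the Bloch mode at $(k^*,E_j^+)$ and the Bloch mode at $(k^*,E_{j+1}^-)$ are each unique up to a scalar factor, and they have different parities: one of them is an even function and the other is an odd function. -/

import Mathlib

open MeasureTheory Filter Topology Set

noncomputable section

namespace Photonic

/-- A piecewise continuous function on the line: on every bounded interval there are only finitely
many points of discontinuity, and the (finite) one-sided limits exist at every point. -/
def PiecewiseContinuous (f : ℝ → ℝ) : Prop :=
  (∀ a b : ℝ, {x ∈ Icc a b | ¬ ContinuousAt f x}.Finite) ∧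
    ∀ x : ℝ, (∃ l : ℝ, Tendsto f (𝓝[<] x) (𝓝 l)) ∧ ∃ r : ℝ, Tendsto f (𝓝[>] x) (𝓝 r)

/-- The parity operator `(P ψ)(x) = ψ(-x)`. -/
def parityOp (ψ : ℝ → ℂ) : ℝ → ℂ := fun x => ψ (-x)

/-- A function has even parity if `P φ = φ`. -/
def IsEvenParity (φ : ℝ → ℂ) : Prop := parityOp φ = φ

/-- A function has odd parity if `P φ = -φ`. -/
def IsOddParity (φ : ℝ → ℂ) : Prop := parityOp φ = -φ

/-- `-(1/ε) (u'/μ)' = f` on `[a, b]`, where `u` is absolutely continuous on `[a, b]` and `v` is the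
absolutely continuous representative of `u'/μ` on `[a, b]`; the derivatives `u' = μ v` and
`v' = -ε f` are taken at almost every point. -/
def SolvesOn (ε μ : ℝ → ℝ) (a b : ℝ) (u v f : ℝ → ℂ) : Prop :=
  AbsolutelyContinuousOnInterval u a b ∧ AbsolutelyContinuousOnInterval v a b ∧
    ∀ᵐ x : ℝ, x ∈ Icc a b →
      HasDerivAt u ((μ x : ℂ) * v x) x ∧ HasDerivAt v (-((ε x : ℂ) * f x)) x

/-- The graph of the operator `L ψ = -(1/ε) (ψ'/μ)'` on the line: `ψ` and `ψ'/μ` are locally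
absolutely continuous and `L ψ = f` almost everywhere. -/
def OperatorGraph (ε μ : ℝ → ℝ) (ψ f : ℝ → ℂ) : Prop :=
  ∃ v : ℝ → ℂ, ∀ a b : ℝ, a ≤ b → SolvesOn ε μ a b ψ v f

/-- The coefficients of an inversion-symmetric periodic photonic operator: piecewise continuous,
positive, of period one, and such that `P L = L P`. -/
structure IsPhotonic (ε μ : ℝ → ℝ) : Prop where
  piecewise_permittivity : PiecewiseContinuous ε
  piecewise_permeability : PiecewiseContinuous μ
  pos_permittivity : ∀ x, 0 < ε x
  pos_permeability : ∀ x, 0 < μ x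
  periodic_permittivity : Function.Periodic ε 1
  periodic_permeability : Function.Periodic μ 1
  commutes : ∀ ψ f : ℝ → ℂ,
    OperatorGraph ε μ ψ f ↔ OperatorGraph ε μ (parityOp ψ) (parityOp f)

/-- The Bloch eigenspace at `(k, E)`: the functions `u` on `[0, 1]`, with `u` and `u'/μ` absolutely
continuous, `u(1) = e^{ik} u(0)`, `(u'/μ)(1) = e^{ik} (u'/μ)(0)` and `L u = E u` on `[0, 1]`, each
extended to the line by `u(x + 1) = e^{ik} u(x)`. The Bloch modes at `(k, E)` are its nonzero
elements. -/
def blochSpace (ε μ : ℝ → ℝ) (k E : ℝ) : Submodule ℂ (ℝ → ℂ) where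
  carrier := {u | (∀ x : ℝ, u (x + 1) = Complex.exp (Complex.I * k) * u x) ∧
    ∃ v : ℝ → ℂ, SolvesOn ε μ 0 1 u v (fun x => (E : ℂ) * u x) ∧
      v 1 = Complex.exp (Complex.I * k) * v 0}
  zero_mem' := by
    refine ⟨fun x => by simp, 0, ⟨?_, ?_, ?_⟩, by simp⟩
    · exact (LipschitzWith.const (0 : ℂ)).lipschitzOnWith.absolutelyContinuousOnInterval
    · exact (LipschitzWith.const (0 : ℂ)).lipschitzOnWith.absolutelyContinuousOnInterval
    · refine Eventually.of_forall fun x _ => ⟨?_, ?_⟩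
      · simp [hasDerivAt_zero]
      · simp [hasDerivAt_zero]
  add_mem' := by
    rintro u₁ u₂ ⟨hq₁, v₁, ⟨hu₁, hv₁, h₁⟩, hb₁⟩ ⟨hq₂, v₂, ⟨hu₂, hv₂, h₂⟩, hb₂⟩
    refine ⟨fun x => ?_, v₁ + v₂, ⟨hu₁.add hu₂, hv₁.add hv₂, ?_⟩, ?_⟩
    · simp only [Pi.add_apply, hq₁ x, hq₂ x]; ring
    · filter_upwards [h₁, h₂] with x hx₁ hx₂ hx
      refine ⟨((hx₁ hx).1.add (hx₂ hx).1).congr_deriv ?_,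
        ((hx₁ hx).2.add (hx₂ hx).2).congr_deriv ?_⟩
      · simp only [Pi.add_apply]; ring
      · simp only [Pi.add_apply]; ring
    · simp only [Pi.add_apply, hb₁, hb₂]; ring
  smul_mem' := by
    rintro c u ⟨hq, v, ⟨hu, hv, h⟩, hb⟩
    refine ⟨fun x => ?_, c • v, ⟨hu.const_smul c, hv.const_smul c, ?_⟩, ?_⟩
    · simp only [Pi.smul_apply, smul_eq_mul, hq x]; ring
    · filter_upwards [h] with x hx hx'
      refine ⟨((hx hx').1.const_smul c).congr_deriv ?_,
        ((hx hx').2.const_smul c).congr_deriv ?_⟩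
      · simp only [Pi.smul_apply, smul_eq_mul]; ring
      · simp only [Pi.smul_apply, smul_eq_mul]; ring
    · simp only [Pi.smul_apply, smul_eq_mul, hb]; ring

/-- The number of eigenvalues `≤ t` of the Floquet-Bloch problem at wavenumber `k`, counted with
multiplicity: an eigenvalue `E` of multiplicity `m` contributes the pairs `(E, 0), …, (E, m - 1)`. -/
def eigenvalueCount (ε μ : ℝ → ℝ) (k t : ℝ) : ℕ∞ :=
  {p : ℝ × ℕ | p.1 ≤ t ∧ p.2 < Module.finrank ℂ (blochSpace ε μ k p.1)}.encard

/-- The dispersion relation `E_j(k)` of the `j`-th band (`j ≥ 1`): the `j`-th eigenvalue at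
wavenumber `k`, in increasing order and counted with multiplicity. -/
def bandEnergy (ε μ : ℝ → ℝ) (j : ℕ) (k : ℝ) : ℝ :=
  sInf {t : ℝ | (j : ℕ∞) ≤ eigenvalueCount ε μ k t}

/-- The lower band edge `E_j^-`, the minimum of `E_j` over the Brillouin zone `[-π, π]`. -/
def bandBottom (ε μ : ℝ → ℝ) (j : ℕ) : ℝ :=
  sInf (bandEnergy ε μ j '' Icc (-Real.pi) Real.pi)

/-- The upper band edge `E_j^+`, the maximum of `E_j` over the Brillouin zone `[-π, π]`. -/
def bandTop (ε μ : ℝ → ℝ) (j : ℕ) : ℝ :=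
  sSup (bandEnergy ε μ j '' Icc (-Real.pi) Real.pi)

end Photonic

end

/-!
Write `u' = μ v`, `v' = -E ε u` for `L u = E u`, and let `c` and `s` be the real solutions with
`(u, v)(0) = (1, 0)` and `(0, 1)`. Commutation with parity forces `ε` and `μ` to be even almost
everywhere (`IsPhotonic.isSymmetricCell`), so `c` is even and `s` is odd. Let `p, q` be the values
of `c` and its quasi-derivative at `1/2`, and `r, w` those of `s`; then `p w - q r = 1`.
Reflecting the cell in its centre `1/2` factorizes the monodromy matrix (`sol_one`):

  `M = [[D, 2 r w], [2 p q, D]]`, with `D = p w + q r = 1 + 2 q r = 2 p w - 1`.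

Hence `E` is an eigenvalue at `k` exactly if `D(E) = cos k` (`finrank_blochSpace_pos_iff`). Where
`D = 1` one of `q`, `r` vanishes, and where `D = -1` one of `p`, `w` does; if it is only one of
them, then the Bloch mode is unique, and it is `c` or `s`.

The band structure enters only through a few properties of `D`. At negative energy `|D| > 1`; the
energies with `D = cos k` are isolated (`eventually_halfDisc_ne`), so that eigenvalues can be
counted; and `D` oscillates between `-1` and `1` up to arbitrarily high energies, because the
Prüfer angle of `c` at `1/2` tends to infinity with the energy (`exists_energy_zeros`), so that
every `E_j(k)` exists and the bands are bounded. An energy with `|D| ≤ 1` is an eigenvalue at some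
`k`, and therefore cannot lie in the gap between `E_j^+` and `E_{j+1}^-`. So `|D| > 1` inside the
gap while `|D| ≤ 1` at the edges, and by continuity `D` takes the same value `1` or `-1` at both
edges, which are therefore eigenvalues at the same `k* ∈ {0, π}`.

For the parities, consider periodic edges, where `q r` is positive inside the gap and zero at its
edges, while `p w = 1 + q r > 0` throughout. Lagrange's identity gives `∂q/∂E = B q - A w` and
`∂r/∂E = G p - B r` with `A = ∫ ε c²`, `B = ∫ ε c s`, `G = ∫ ε s²` over the half cell. If `q`
vanished at both edges, the sign of the derivative of `q r` there would force `r w` to change its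
sign inside the gap, although neither `r` nor `w` has a zero; the same holds with the roles of `q`
and `r` exchanged. Both cannot vanish at one edge, since then `q r` would be negative next to it.
So one edge is a zero of `q`, with an even mode, and the other one a zero of `r`, with an odd mode
(`zeros_alternate`). The antiperiodic case is the same with `(p, -w, r, -q)` in place of
`(q, r, w, p)`.
-/

noncomputable section

namespace Photonic

/-! ### Weights -/

/-- The regularity of a coefficient that the spectral theory below relies on: almost everywhere
measurable, pointwise positive, and bounded above. No positive lower bound is required, since a
one-sided limit of a positive piecewise continuous function may vanish. -/
structure IsWeight (ρ : ℝ → ℝ) : Prop where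
  aestronglyMeasurable : AEStronglyMeasurable ρ volume
  pos : ∀ x, 0 < ρ x
  bddAbove : ∃ K, ∀ x, ρ x ≤ K

theorem IsWeight.exists_abs_le {ρ : ℝ → ℝ} (hρ : IsWeight ρ) : ∃ K, 0 < K ∧ ∀ x, |ρ x| ≤ K := by
  obtain ⟨K, hK⟩ := hρ.bddAbove
  exact ⟨K, (hρ.pos 0).trans_le (hK 0), fun x => by rw [abs_of_pos (hρ.pos x)]; exact hK x⟩

theorem IsWeight.intervalIntegrable {ρ : ℝ → ℝ} (hρ : IsWeight ρ) (a b : ℝ) :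
    IntervalIntegrable ρ volume a b := by
  obtain ⟨K, -, hK⟩ := hρ.exists_abs_le
  rw [intervalIntegrable_iff]
  refine Measure.integrableOn_of_bounded (M := K) (by simp) hρ.aestronglyMeasurable ?_
  exact Eventually.of_forall fun x => by simpa using hK x

theorem IsWeight.intervalIntegrable_mul {ρ f : ℝ → ℝ} (hρ : IsWeight ρ) (hf : Continuous f)
    (a b : ℝ) : IntervalIntegrable (fun x => ρ x * f x) volume a b :=
  (hρ.intervalIntegrable a b).mul_continuousOn hf.continuousOn

theorem IsWeight.integral_pos {ρ : ℝ → ℝ} (hρ : IsWeight ρ) {a b : ℝ} (hab : a < b) :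
    0 < ∫ x in a..b, ρ x :=
  intervalIntegral.intervalIntegral_pos_of_pos_on (hρ.intervalIntegrable a b)
    (fun x _ => hρ.pos x) hab

/-- The weighted integral of a nonnegative continuous function that does not vanish identically is
positive. -/
theorem IsWeight.integral_mul_pos {ρ f : ℝ → ℝ} (hρ : IsWeight ρ) (hf : Continuous f)
    (hf0 : ∀ x, 0 ≤ f x) {a b x₀ : ℝ} (hx₀ : x₀ ∈ Ioo a b) (hne : f x₀ ≠ 0) :
    0 < ∫ x in a..b, ρ x * f x := by
  have hab : a < b := hx₀.1.trans hx₀.2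
  rw [intervalIntegral.integral_pos_iff_support_of_nonneg_ae
    (Eventually.of_forall fun x => mul_nonneg (hρ.pos x).le (hf0 x))
    (hρ.intervalIntegrable_mul hf a b)]
  refine ⟨hab, ?_⟩
  have hopen : IsOpen (Function.support f ∩ Ioo a b) := hf.isOpen_support.inter isOpen_Ioo
  refine (hopen.measure_pos volume ⟨x₀, hne, hx₀⟩).trans_le (measure_mono ?_)
  rintro x ⟨hx, hx'⟩
  exact ⟨mul_ne_zero (hρ.pos x).ne' hx, Ioo_subset_Ioc_self hx'⟩

theorem PiecewiseContinuous.aestronglyMeasurable {f : ℝ → ℝ} (hf : PiecewiseContinuous f) :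
    AEStronglyMeasurable f volume := by
  have hcount : {x | ¬ ContinuousAt f x}.Countable := by
    have hsub : {x | ¬ ContinuousAt f x} ⊆
        ⋃ n : ℕ, {x ∈ Icc (-(n : ℝ)) n | ¬ ContinuousAt f x} := by
      intro x hx
      obtain ⟨n, hn⟩ := exists_nat_ge |x|
      exact mem_iUnion.2 ⟨n, abs_le.1 hn, hx⟩
    exact (countable_iUnion fun n => (hf.1 _ _).countable).mono hsub
  have hmeas : MeasurableSet {x | ContinuousAt f x} := by
    have := hcount.measurableSet.compl
    simpa [compl_ofPred] using this
  have hc : ContinuousOn f {x | ContinuousAt f x} := fun x hx =>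
    ContinuousAt.continuousWithinAt hx
  have h := hc.aestronglyMeasurable (μ := volume) hmeas
  have hae : ∀ᵐ x ∂(volume : Measure ℝ), x ∈ {x | ContinuousAt f x} := by
    rw [ae_iff]; exact hcount.measure_zero _
  rwa [Measure.restrict_eq_self_of_ae_mem hae] at h

/-- A periodic piecewise continuous function is bounded: one-sided limits bound it near each point
of the compact unit interval. -/
theorem PiecewiseContinuous.bddAbove {f : ℝ → ℝ} (hf : PiecewiseContinuous f)
    (hper : Function.Periodic f 1) : ∃ K, ∀ x, f x ≤ K := by
  have hcomp : ∃ K, ∀ x ∈ Icc (0 : ℝ) 1, f x ≤ K := by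
    refine (isCompact_Icc (a := (0 : ℝ)) (b := 1)).induction_on
      (p := fun s => ∃ K, ∀ x ∈ s, f x ≤ K) ⟨0, by simp⟩ ?_ ?_ ?_
    · rintro s t hst ⟨K, hK⟩
      exact ⟨K, fun x hx => hK x (hst hx)⟩
    · rintro s t ⟨K, hK⟩ ⟨L, hL⟩
      refine ⟨max K L, ?_⟩
      rintro x (hx | hx)
      · exact (hK x hx).trans (le_max_left _ _)
      · exact (hL x hx).trans (le_max_right _ _)
    · intro x _
      obtain ⟨⟨l, hl⟩, r, hr⟩ := hf.2 x
      have h1 : ∀ᶠ y in 𝓝[<] x, f y ≤ max (max (l + 1) (r + 1)) (f x) :=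
        (hl.eventually_lt_const (lt_add_one l)).mono fun y hy =>
          hy.le.trans ((le_max_left _ _).trans (le_max_left _ _))
      have h2 : ∀ᶠ y in 𝓝[>] x, f y ≤ max (max (l + 1) (r + 1)) (f x) :=
        (hr.eventually_lt_const (lt_add_one r)).mono fun y hy =>
          hy.le.trans ((le_max_right _ _).trans (le_max_left _ _))
      have h3 : ∀ᶠ y in 𝓝[≠] x, f y ≤ max (max (l + 1) (r + 1)) (f x) := by
        rw [← nhdsLT_sup_nhdsGT]; exact eventually_sup.2 ⟨h1, h2⟩
      have h4 : ∀ᶠ y in 𝓝 x, f y ≤ max (max (l + 1) (r + 1)) (f x) := by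
        rw [eventually_nhdsWithin_iff] at h3
        filter_upwards [h3] with y hy
        rcases eq_or_ne y x with rfl | hne
        · exact le_max_right _ _
        · exact hy hne
      exact ⟨_, mem_nhdsWithin_of_mem_nhds h4, _, fun y hy => hy⟩
  obtain ⟨K, hK⟩ := hcomp
  refine ⟨K, fun x => ?_⟩
  obtain ⟨y, hy, hxy⟩ := hper.exists_mem_Ico₀ one_pos x
  rw [hxy]
  exact hK y (Ico_subset_Icc_self hy)

/-! ### Absolutely continuous functions with a given derivative -/

/-- `f` is absolutely continuous between `a` and `b`, with derivative `f'` almost everywhere. -/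
def HasACDeriv {F : Type*} [NormedAddCommGroup F] [NormedSpace ℝ F] (f f' : ℝ → F) (a b : ℝ) :
    Prop :=
  AbsolutelyContinuousOnInterval f a b ∧ ∀ᵐ x : ℝ, x ∈ uIcc a b → HasDerivAt f (f' x) x

namespace HasACDeriv

variable {F : Type*} [NormedAddCommGroup F] [NormedSpace ℝ F] {f f' g g' : ℝ → F} {a b : ℝ}

theorem congr_deriv (h : HasACDeriv f f' a b) (hg : ∀ᵐ x : ℝ, x ∈ uIcc a b → f' x = g' x) :
    HasACDeriv f g' a b := by
  refine ⟨h.1, ?_⟩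
  filter_upwards [h.2, hg] with x hx hx' hmem
  exact hx' hmem ▸ hx hmem

theorem add (hf : HasACDeriv f f' a b) (hg : HasACDeriv g g' a b) :
    HasACDeriv (fun x => f x + g x) (fun x => f' x + g' x) a b := by
  refine ⟨hf.1.fun_add hg.1, ?_⟩
  filter_upwards [hf.2, hg.2] with x hx hx' hmem
  exact (hx hmem).fun_add (hx' hmem)

theorem sub (hf : HasACDeriv f f' a b) (hg : HasACDeriv g g' a b) :
    HasACDeriv (fun x => f x - g x) (fun x => f' x - g' x) a b := by
  refine ⟨hf.1.fun_sub hg.1, ?_⟩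
  filter_upwards [hf.2, hg.2] with x hx hx' hmem
  exact (hx hmem).fun_sub (hx' hmem)

theorem smul {r r' : ℝ → ℝ} (hr : HasACDeriv r r' a b) (hf : HasACDeriv f f' a b) :
    HasACDeriv (fun x => r x • f x) (fun x => r' x • f x + r x • f' x) a b := by
  refine ⟨hr.1.fun_smul hf.1, ?_⟩
  filter_upwards [hr.2, hf.2] with x hx hx' hmem
  refine ((hx hmem).fun_smul (hx' hmem)).congr_deriv (add_comm _ _)

theorem mul {r r' s s' : ℝ → ℝ} (hr : HasACDeriv r r' a b) (hs : HasACDeriv s s' a b) :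
    HasACDeriv (fun x => r x * s x) (fun x => r' x * s x + r x * s' x) a b :=
  hr.smul hs

theorem eq_of_deriv_eq_zero (h : HasACDeriv f f' a b)
    (h0 : ∀ᵐ x : ℝ, x ∈ uIcc a b → f' x = 0) {x : ℝ} (hx : x ∈ uIcc a b) : f x = f a := by
  obtain ⟨C, hC⟩ := h.1.const_of_ae_hasDerivAt_zero (h.congr_deriv h0).2
  rw [hC x hx, hC a left_mem_uIcc]

theorem integral_eq {r r' : ℝ → ℝ} (h : HasACDeriv r r' a b) :
    ∫ x in a..b, r' x = r b - r a := by
  rw [← h.1.integral_deriv_eq_sub]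
  refine intervalIntegral.integral_congr_ae ?_
  filter_upwards [h.2] with x hx hmem
  exact (hx (uIoc_subset_uIcc hmem)).deriv.symm

/-- A primitive of a locally integrable function is absolutely continuous on every interval. -/
theorem of_integral {r r' : ℝ → ℝ} (hint : ∀ a b, IntervalIntegrable r' volume a b)
    (h : ∀ a b, r b - r a = ∫ x in a..b, r' x) (a b : ℝ) : HasACDeriv r r' a b := by
  have hr : r = fun x => r a + ∫ t in a..x, r' t := by
    funext x; rw [← h a x]; ring
  constructor
  · rw [hr]
    exact (LipschitzWith.const (r a)).lipschitzOnWith.absolutelyContinuousOnInterval.fun_add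
      ((hint a b).absolutelyContinuousOnInterval_intervalIntegral left_mem_uIcc)
  · filter_upwards [(hint a b).ae_hasDerivAt_integral] with x hx hmem
    rw [hr]
    exact (hx hmem a left_mem_uIcc).const_add _

theorem of_hasDerivAt {r r' : ℝ → ℝ} (hr : ContDiff ℝ 1 r) (h : ∀ x, HasDerivAt r (r' x) x)
    (a b : ℝ) : HasACDeriv r r' a b :=
  ⟨hr.contDiffOn.absolutelyContinuousOnInterval, Eventually.of_forall fun x _ => h x⟩

theorem ofReal {r r' : ℝ → ℝ} (h : HasACDeriv r r' a b) :
    HasACDeriv (fun x => (r x : ℂ)) (fun x => (r' x : ℂ)) a b := by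
  refine ⟨?_, ?_⟩
  · have := h.1
    simp only [AbsolutelyContinuousOnInterval] at this ⊢
    simpa [Complex.dist_eq, ← Complex.ofReal_sub, Complex.norm_real, Real.dist_eq] using this
  · filter_upwards [h.2] with x hx hmem
    exact (hx hmem).ofReal_comp

theorem const_mul {z z' : ℝ → ℂ} (c : ℂ) (h : HasACDeriv z z' a b) :
    HasACDeriv (fun x => c * z x) (fun x => c * z' x) a b := by
  refine ⟨h.1.const_smul c, ?_⟩
  filter_upwards [h.2] with x hx hmem
  exact (hx hmem).const_mul c

/-- A Lipschitz function of an absolutely continuous function. -/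
theorem comp_lipschitz {r r' : ℝ → ℝ} {φ φ' : ℝ → ℝ} (hr : HasACDeriv r r' a b)
    (hlip : LipschitzWith 1 φ) (hφ : ∀ y, HasDerivAt φ (φ' y) y) :
    HasACDeriv (fun x => φ (r x)) (fun x => φ' (r x) * r' x) a b := by
  refine ⟨?_, ?_⟩
  · refine squeeze_zero (fun t => Finset.sum_nonneg fun i _ => dist_nonneg) (fun t => ?_) hr.1
    exact Finset.sum_le_sum fun i _ => by simpa using hlip.dist_le_mul (r (t.2 i).1) (r (t.2 i).2)
  · filter_upwards [hr.2] with x hx hmem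
    exact (hφ (r x)).comp x (hx hmem)

end HasACDeriv

/-! ### Fundamental solutions -/

/-- `u' = μ v`, `v' = -E ε u` on the whole line, in integrated form: `u` is a real solution of
`L u = E u` and `v` is its quasi-derivative `u'/μ`. -/
structure IsSol (ε μ : ℝ → ℝ) (E : ℝ) (u v : ℝ → ℝ) : Prop where
  continuous_fst : Continuous u
  continuous_snd : Continuous v
  fst_sub : ∀ a b, u b - u a = ∫ x in a..b, μ x * v x
  snd_sub : ∀ a b, v b - v a = ∫ x in a..b, ε x * (-E * u x)

/-- The terms of the Picard series of the initial value problem `(u, v)(0) = (a, b)` for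
`u' = μ v`, `v' = -E ε u`: constants, then iterated integrals. -/
def picard (ε μ : ℝ → ℝ) (E a b : ℝ) : ℕ → (ℝ → ℝ) × (ℝ → ℝ)
  | 0 => (fun _ => a, fun _ => b)
  | n + 1 => (fun x => ∫ t in (0 : ℝ)..x, μ t * (picard ε μ E a b n).2 t,
      fun x => ∫ t in (0 : ℝ)..x, ε t * (-E * (picard ε μ E a b n).1 t))

/-- The solution `u` of `u' = μ v`, `v' = -E ε u`, `(u, v)(0) = (a, b)`. -/
def solU (ε μ : ℝ → ℝ) (a b E x : ℝ) : ℝ := ∑' n, (picard ε μ E a b n).1 x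

/-- The quasi-derivative `v = u'/μ` of the solution with `(u, v)(0) = (a, b)`. -/
def solV (ε μ : ℝ → ℝ) (a b E x : ℝ) : ℝ := ∑' n, (picard ε μ E a b n).2 x

variable {ε μ : ℝ → ℝ}

theorem continuous_picard (hε : IsWeight ε) (hμ : IsWeight μ) (E a b : ℝ) (n : ℕ) :
    Continuous (picard ε μ E a b n).1 ∧ Continuous (picard ε μ E a b n).2 := by
  induction n with
  | zero => exact ⟨continuous_const, continuous_const⟩
  | succ n ih =>
    exact ⟨intervalIntegral.continuous_primitive (fun c d => hμ.intervalIntegrable_mul ih.2 c d) 0,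
      intervalIntegral.continuous_primitive
        (fun c d => hε.intervalIntegrable_mul (continuous_const.mul ih.1) c d) 0⟩

theorem abs_integral_le_of_abs_le_pow {g : ℝ → ℝ} {K C : ℝ} {n : ℕ}
    (hg : ∀ t, |g t| ≤ K * (C * ((K * |t|) ^ n / n.factorial))) (x : ℝ) :
    |∫ t in (0 : ℝ)..x, g t| ≤ C * ((K * |x|) ^ (n + 1) / (n + 1).factorial) := by
  have h1 : |∫ t in (0 : ℝ)..x, g t| ≤
      ∫ t in uIoc 0 x, K * (C * ((K * |t|) ^ n / n.factorial)) := by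
    rw [← Real.norm_eq_abs, intervalIntegral.norm_integral_eq_norm_integral_uIoc]
    refine MeasureTheory.norm_integral_le_of_norm_le ?_
      (Eventually.of_forall fun t => (Real.norm_eq_abs _).trans_le (hg t))
    have : Continuous fun t : ℝ => K * (C * ((K * |t|) ^ n / n.factorial)) := by fun_prop
    exact (this.intervalIntegrable 0 x).def'
  refine h1.trans_eq ?_
  have h2 : ∀ t : ℝ, K * (C * ((K * |t|) ^ n / n.factorial)) =
      (K ^ (n + 1) * C / n.factorial) * |t - 0| ^ n := by
    intro t; rw [sub_zero, mul_pow]; ring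
  simp_rw [h2]
  rw [MeasureTheory.integral_const_mul, integral_pow_abs_sub_uIoc, sub_zero, Nat.factorial_succ]
  push_cast
  have := Nat.factorial_ne_zero n
  field_simp
  rw [mul_pow]
  ring

theorem abs_picard_le {E a b K C : ℝ} (hμ : ∀ x, |μ x| ≤ K) (hε : ∀ x, |ε x| * |E| ≤ K)
    (ha : |a| ≤ C) (hb : |b| ≤ C) (n : ℕ) :
    (∀ x, |(picard ε μ E a b n).1 x| ≤ C * ((K * |x|) ^ n / n.factorial)) ∧
      ∀ x, |(picard ε μ E a b n).2 x| ≤ C * ((K * |x|) ^ n / n.factorial) := by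
  have hK : 0 ≤ K := (abs_nonneg _).trans (hμ 0)
  induction n with
  | zero => simpa [picard] using ⟨ha, hb⟩
  | succ n ih =>
    refine ⟨fun x => abs_integral_le_of_abs_le_pow (fun t => ?_) x,
      fun x => abs_integral_le_of_abs_le_pow (fun t => ?_) x⟩
    · rw [abs_mul]
      exact mul_le_mul (hμ t) (ih.2 t) (abs_nonneg _) hK
    · rw [← mul_assoc, abs_mul, abs_mul, abs_neg]
      exact mul_le_mul (hε t) (ih.1 t) (abs_nonneg _) hK

theorem hasSum_expBound (C y : ℝ) :
    HasSum (fun n : ℕ => C * (y ^ n / n.factorial)) (C * Real.exp y) := by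
  have h := NormedSpace.expSeries_div_hasSum_exp (𝔸 := ℝ) y
  rw [← Real.exp_eq_exp_ℝ] at h
  exact h.mul_left C

theorem exists_picard_constant (hε : IsWeight ε) (hμ : IsWeight μ) (R : ℝ) (hR : 0 ≤ R) :
    ∃ K, 0 ≤ K ∧ ∀ E, |E| ≤ R → (∀ x, |μ x| ≤ K) ∧ ∀ x, |ε x| * |E| ≤ K := by
  obtain ⟨K, hK, hεK⟩ := hε.exists_abs_le
  obtain ⟨L, hL, hμL⟩ := hμ.exists_abs_le
  refine ⟨L + K * R, by positivity, fun E hE => ⟨fun x => ?_, fun x => ?_⟩⟩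
  · have := hμL x
    have : 0 ≤ K * R := by positivity
    linarith
  · have := mul_le_mul (hεK x) hE (abs_nonneg _) hK.le
    linarith

/-- The Picard series is bounded by the exponential series, locally uniformly in the energy. -/
theorem exists_abs_sol_le (hε : IsWeight ε) (hμ : IsWeight μ) (a b R : ℝ) (hR : 0 ≤ R) :
    ∃ M, ∀ E, |E| ≤ R → ∀ x, |x| ≤ 1 → |solU ε μ a b E x| ≤ M ∧ |solV ε μ a b E x| ≤ M := by
  obtain ⟨K, hK, h⟩ := exists_picard_constant hε hμ R hR
  refine ⟨max |a| |b| * Real.exp (K * 1), fun E hE x hx => ?_⟩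
  have hb := abs_picard_le (h E hE).1 (h E hE).2 (le_max_left |a| |b|) (le_max_right |a| |b|)
  have hle : max |a| |b| * Real.exp (K * |x|) ≤ max |a| |b| * Real.exp (K * 1) := by gcongr
  have h1 : ‖solU ε μ a b E x‖ ≤ _ :=
    tsum_of_norm_bounded (hasSum_expBound (max |a| |b|) (K * |x|)) fun n => (hb n).1 x
  have h2 : ‖solV ε μ a b E x‖ ≤ _ :=
    tsum_of_norm_bounded (hasSum_expBound (max |a| |b|) (K * |x|)) fun n => (hb n).2 x
  exact ⟨h1.trans hle, h2.trans hle⟩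

theorem continuous_tsum_of_abs_le {f : ℕ → ℝ → ℝ} {K C : ℝ} (hK : 0 ≤ K) (hC : 0 ≤ C)
    (hf : ∀ n, Continuous (f n))
    (hb : ∀ n x, |f n x| ≤ C * ((K * |x|) ^ n / n.factorial)) :
    Continuous fun x => ∑' n, f n x := by
  rw [continuous_iff_continuousAt]
  intro x
  have hnhds : Icc (-(|x| + 1)) (|x| + 1) ∈ 𝓝 x :=
    Icc_mem_nhds (by linarith [neg_abs_le x]) (by linarith [le_abs_self x])
  refine ContinuousOn.continuousAt ?_ hnhds
  refine continuousOn_tsum (fun n => (hf n).continuousOn)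
    (hasSum_expBound C (K * (|x| + 1))).summable fun n y hy => ?_
  refine (hb n y).trans ?_
  have := abs_le.2 hy
  gcongr

theorem integral_tsum_eq {ρ : ℝ → ℝ} {f : ℕ → ℝ → ℝ} {K C : ℝ} (hρ : IsWeight ρ) (hK : 0 ≤ K)
    (hC : 0 ≤ C) (hf : ∀ n, Continuous (f n))
    (hb : ∀ n x, |f n x| ≤ C * ((K * |x|) ^ n / n.factorial)) (x : ℝ) :
    HasSum (fun n => ∫ t in (0 : ℝ)..x, ρ t * f n t) (∫ t in (0 : ℝ)..x, ρ t * ∑' n, f n t) := by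
  obtain ⟨L, hL, hρL⟩ := hρ.exists_abs_le
  refine intervalIntegral.hasSum_integral_of_dominated_convergence
    (fun n _ => L * (C * ((K * |x|) ^ n / n.factorial))) (fun n => ?_) (fun n => ?_) ?_ ?_ ?_
  · exact (hρ.intervalIntegrable_mul (hf n) 0 x).def'.aestronglyMeasurable
  · refine Eventually.of_forall fun t ht => ?_
    rw [norm_mul, Real.norm_eq_abs, Real.norm_eq_abs]
    have htx : |t| ≤ |x| := by
      have := abs_sub_left_of_mem_uIcc (uIoc_subset_uIcc ht)
      simpa using this
    refine mul_le_mul (hρL t) ((hb n t).trans ?_) (abs_nonneg _) hL.le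
    gcongr
  · exact Eventually.of_forall fun t _ => ((hasSum_expBound C (K * |x|)).mul_left L).summable
  · exact intervalIntegrable_const
  · refine Eventually.of_forall fun t _ => (Summable.hasSum ?_).mul_left _
    exact Summable.of_norm_bounded (hasSum_expBound C (K * |t|)).summable fun n => hb n t

theorem isSol_sol (hε : IsWeight ε) (hμ : IsWeight μ) (a b E : ℝ) :
    IsSol ε μ E (solU ε μ a b E) (solV ε μ a b E) := by
  obtain ⟨K, hK, h⟩ := exists_picard_constant hε hμ |E| (abs_nonneg E)
  have hb := abs_picard_le (h E le_rfl).1 (h E le_rfl).2 (le_max_left |a| |b|)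
    (le_max_right |a| |b|)
  have hc := continuous_picard hε hμ E a b
  have hC : 0 ≤ max |a| |b| := (abs_nonneg a).trans (le_max_left _ _)
  have hu : Continuous (solU ε μ a b E) :=
    continuous_tsum_of_abs_le hK hC (fun n => (hc n).1) fun n => (hb n).1
  have hv : Continuous (solV ε μ a b E) :=
    continuous_tsum_of_abs_le hK hC (fun n => (hc n).2) fun n => (hb n).2
  have hu' : ∀ x, solU ε μ a b E x = a + ∫ t in (0 : ℝ)..x, μ t * solV ε μ a b E t := by
    intro x
    have hs := integral_tsum_eq hμ hK hC (fun n => (hc n).2) (fun n => (hb n).2) x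
    have hs' : HasSum (fun n => (picard ε μ E a b (n + 1)).1 x)
        ((a + ∫ t in (0 : ℝ)..x, μ t * solV ε μ a b E t) -
          ∑ i ∈ Finset.range 1, (picard ε μ E a b i).1 x) := by
      simpa [picard, solV] using hs
    exact ((hasSum_nat_add_iff' (f := fun n => (picard ε μ E a b n).1 x) 1).1 hs').tsum_eq
  have hv' : ∀ x, solV ε μ a b E x =
      b + ∫ t in (0 : ℝ)..x, ε t * (-E * solU ε μ a b E t) := by
    intro x
    have hs := (integral_tsum_eq hε hK hC (fun n => (hc n).1) (fun n => (hb n).1) x).mul_left (-E)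
    simp_rw [← intervalIntegral.integral_const_mul, mul_left_comm (-E)] at hs
    have hs' : HasSum (fun n => (picard ε μ E a b (n + 1)).2 x)
        ((b + ∫ t in (0 : ℝ)..x, ε t * (-E * solU ε μ a b E t)) -
          ∑ i ∈ Finset.range 1, (picard ε μ E a b i).2 x) := by
      simpa [picard, solU] using hs
    exact ((hasSum_nat_add_iff' (f := fun n => (picard ε μ E a b n).2 x) 1).1 hs').tsum_eq
  have hμi := hμ.intervalIntegrable_mul hv
  have hu2 : Continuous fun x => -E * solU ε μ a b E x := continuous_const.mul hu
  have hεi := hε.intervalIntegrable_mul hu2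
  refine ⟨hu, hv, fun c d => ?_, fun c d => ?_⟩
  · rw [hu' d, hu' c, ← intervalIntegral.integral_interval_sub_left (hμi 0 d) (hμi 0 c)]
    ring
  · rw [hv' d, hv' c, ← intervalIntegral.integral_interval_sub_left (hεi 0 d) (hεi 0 c)]
    ring

theorem solU_zero (a b E : ℝ) : solU ε μ a b E 0 = a := by
  rw [solU, tsum_eq_single 0 fun n hn => ?_]
  · rfl
  · obtain ⟨m, rfl⟩ := Nat.exists_eq_succ_of_ne_zero hn
    simp [picard]

theorem solV_zero (a b E : ℝ) : solV ε μ a b E 0 = b := by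
  rw [solV, tsum_eq_single 0 fun n hn => ?_]
  · rfl
  · obtain ⟨m, rfl⟩ := Nat.exists_eq_succ_of_ne_zero hn
    simp [picard]

namespace IsSol

variable {E : ℝ} {u v : ℝ → ℝ}

theorem hasACDeriv_fst (h : IsSol ε μ E u v) (hμ : IsWeight μ) (a b : ℝ) :
    HasACDeriv u (fun x => μ x * v x) a b :=
  HasACDeriv.of_integral (hμ.intervalIntegrable_mul h.continuous_snd) h.fst_sub a b

theorem hasACDeriv_snd (h : IsSol ε μ E u v) (hε : IsWeight ε) (a b : ℝ) :
    HasACDeriv v (fun x => ε x * (-E * u x)) a b :=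
  HasACDeriv.of_integral (hε.intervalIntegrable_mul (continuous_const.mul h.continuous_fst))
    h.snd_sub a b

/-- Lagrange's identity for the Wronskian of two solutions at possibly different energies, one of
them real and the other one vector valued. -/
theorem hasACDeriv_wronskian {F : Type*} [NormedAddCommGroup F] [NormedSpace ℝ F]
    (h : IsSol ε μ E u v) (hε : IsWeight ε) (hμ : IsWeight μ) {E' a b : ℝ} {y z : ℝ → F}
    (hy : HasACDeriv y (fun x => μ x • z x) a b)
    (hz : HasACDeriv z (fun x => -((E' * ε x) • y x)) a b) :
    HasACDeriv (fun x => u x • z x - v x • y x)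
      (fun x => ((E - E') * (ε x * u x)) • y x) a b := by
  refine (((h.hasACDeriv_fst hμ a b).smul hz).sub
    ((h.hasACDeriv_snd hε a b).smul hy)).congr_deriv (Eventually.of_forall fun x _ => ?_)
  module

theorem wronskian_sub (h : IsSol ε μ E u v) (hε : IsWeight ε) (hμ : IsWeight μ) {E' : ℝ}
    {y z : ℝ → ℝ} (h' : IsSol ε μ E' y z) (a b : ℝ) :
    (u b * z b - v b * y b) - (u a * z a - v a * y a) =
      (E - E') * ∫ x in a..b, ε x * (u x * y x) := by
  have hw := h.hasACDeriv_wronskian hε hμ (E' := E') (h'.hasACDeriv_fst hμ a b)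
    ((h'.hasACDeriv_snd hε a b).congr_deriv (g' := fun x => -((E' * ε x) • y x))
      (Eventually.of_forall fun x _ => by simp only [smul_eq_mul]; ring))
  rw [← intervalIntegral.integral_const_mul]
  refine hw.integral_eq.symm.trans (intervalIntegral.integral_congr fun x _ => ?_)
  simp only [smul_eq_mul]
  ring

end IsSol

theorem wronskian_eq_one (hε : IsWeight ε) (hμ : IsWeight μ) (E x : ℝ) :
    solU ε μ 1 0 E x * solV ε μ 0 1 E x - solV ε μ 1 0 E x * solU ε μ 0 1 E x = 1 := by
  have h := (isSol_sol hε hμ 1 0 E).wronskian_sub hε hμ (isSol_sol hε hμ 0 1 E) 0 x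
  simp only [solU_zero, solV_zero, sub_self, zero_mul] at h
  linarith

/-- Uniqueness for the initial value problem: a vector valued solution is the combination of the
fundamental solutions prescribed by its initial values. -/
theorem eq_smul_add_smul {F : Type*} [NormedAddCommGroup F] [NormedSpace ℝ F]
    (hε : IsWeight ε) (hμ : IsWeight μ) {E b : ℝ} {y z : ℝ → F}
    (hy : HasACDeriv y (fun x => μ x • z x) 0 b)
    (hz : HasACDeriv z (fun x => -((E * ε x) • y x)) 0 b) {x : ℝ} (hx : x ∈ uIcc 0 b) :
    y x = solU ε μ 1 0 E x • y 0 + solU ε μ 0 1 E x • z 0 ∧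
      z x = solV ε μ 1 0 E x • y 0 + solV ε μ 0 1 E x • z 0 := by
  have hc := ((isSol_sol hε hμ 1 0 E).hasACDeriv_wronskian hε hμ hy hz).eq_of_deriv_eq_zero
    (Eventually.of_forall fun x _ => by simp) hx
  have hs := ((isSol_sol hε hμ 0 1 E).hasACDeriv_wronskian hε hμ hy hz).eq_of_deriv_eq_zero
    (Eventually.of_forall fun x _ => by simp) hx
  simp only [solU_zero, solV_zero, one_smul, zero_smul, sub_zero, zero_sub] at hc hs
  have hw := wronskian_eq_one hε hμ E x
  rw [← hc, ← neg_eq_iff_eq_neg.2 hs]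
  constructor
  · have : y x = (solU ε μ 1 0 E x * solV ε μ 0 1 E x - solV ε μ 1 0 E x * solU ε μ 0 1 E x) •
      y x := by rw [hw, one_smul]
    refine this.trans ?_
    module
  · have : z x = (solU ε μ 1 0 E x * solV ε μ 0 1 E x - solV ε μ 1 0 E x * solU ε μ 0 1 E x) •
      z x := by rw [hw, one_smul]
    refine this.trans ?_
    module

theorem IsSol.eq_add (hε : IsWeight ε) (hμ : IsWeight μ) {E : ℝ} {y z : ℝ → ℝ}
    (h : IsSol ε μ E y z) (x : ℝ) :
    y x = solU ε μ 1 0 E x * y 0 + solU ε μ 0 1 E x * z 0 ∧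
      z x = solV ε μ 1 0 E x * y 0 + solV ε μ 0 1 E x * z 0 :=
  eq_smul_add_smul hε hμ (h.hasACDeriv_fst hμ 0 x)
    ((h.hasACDeriv_snd hε 0 x).congr_deriv (Eventually.of_forall fun x _ => by
      simp only [smul_eq_mul]; ring)) right_mem_uIcc

/-! ### Dependence on the energy -/

/-- Variation of constants: the dependence of a solution with fixed initial values on the energy. -/
theorem sol_eq_add (hε : IsWeight ε) (hμ : IsWeight μ) (a b E F x : ℝ) :
    solU ε μ a b F x = solU ε μ a b E x + (F - E) *
      (solU ε μ 1 0 E x * (∫ t in (0 : ℝ)..x, ε t * (solU ε μ 0 1 E t * solU ε μ a b F t)) -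
        solU ε μ 0 1 E x * ∫ t in (0 : ℝ)..x, ε t * (solU ε μ 1 0 E t * solU ε μ a b F t)) ∧
    solV ε μ a b F x = solV ε μ a b E x + (F - E) *
      (solV ε μ 1 0 E x * (∫ t in (0 : ℝ)..x, ε t * (solU ε μ 0 1 E t * solU ε μ a b F t)) -
        solV ε μ 0 1 E x * ∫ t in (0 : ℝ)..x, ε t * (solU ε μ 1 0 E t * solU ε μ a b F t)) := by
  have hF := isSol_sol hε hμ a b F
  have hc := (isSol_sol hε hμ 1 0 E).wronskian_sub hε hμ hF 0 x
  have hs := (isSol_sol hε hμ 0 1 E).wronskian_sub hε hμ hF 0 x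
  have hE := (isSol_sol hε hμ a b E).eq_add hε hμ x
  have hw := wronskian_eq_one hε hμ E x
  simp only [solU_zero, solV_zero] at hc hs hE
  rw [hE.1, hE.2]
  constructor
  · linear_combination (-solU ε μ a b F x) * hw + solU ε μ 0 1 E x * hc - solU ε μ 1 0 E x * hs
  · linear_combination (-solV ε μ a b F x) * hw + solV ε μ 0 1 E x * hc - solV ε μ 1 0 E x * hs

theorem exists_abs_integral_le (hε : IsWeight ε) (hμ : IsWeight μ) (a b a' b' E : ℝ) {x : ℝ}
    (hx : |x| ≤ 1) : ∃ M, ∀ F, |F| ≤ |E| + 1 →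
      |∫ t in (0 : ℝ)..x, ε t * (solU ε μ a' b' E t * solU ε μ a b F t)| ≤ M := by
  obtain ⟨K, hK, hεK⟩ := hε.exists_abs_le
  obtain ⟨M, hM⟩ := exists_abs_sol_le hε hμ a b (|E| + 1) (by positivity)
  obtain ⟨M', hM'⟩ := exists_abs_sol_le hε hμ a' b' |E| (by positivity)
  refine ⟨K * (M' * M) * |x - 0|, fun F hF => ?_⟩
  rw [← Real.norm_eq_abs]
  refine intervalIntegral.norm_integral_le_of_norm_le_const fun t ht => ?_
  have htx : |t| ≤ |x| := by
    have := abs_sub_left_of_mem_uIcc (uIoc_subset_uIcc ht)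
    simpa using this
  have h1 := (hM' E le_rfl t (htx.trans hx)).1
  have h2 := (hM F hF t (htx.trans hx)).1
  have h3 := (abs_nonneg _).trans h1
  rw [Real.norm_eq_abs, abs_mul, abs_mul]
  have := hεK t
  gcongr

theorem tendsto_sub_mul_of_bounded {g : ℝ → ℝ} {E M : ℝ} (h : ∀ F, |F| ≤ |E| + 1 → |g F| ≤ M) :
    Tendsto (fun F => (F - E) * g F) (𝓝 E) (𝓝 0) := by
  have h0 : Tendsto (fun F : ℝ => F - E) (𝓝 E) (𝓝 0) := by
    have : Continuous fun F : ℝ => F - E := by fun_prop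
    simpa using this.tendsto E
  refine h0.zero_mul_isBoundedUnder_le ⟨M, ?_⟩
  rw [eventually_map]
  have : ∀ᶠ F in 𝓝 E, |F| < |E| + 1 :=
    continuous_abs.continuousAt.eventually_lt_const (lt_add_one _)
  exact this.mono fun F hF => h F hF.le

theorem continuous_sol_energy (hε : IsWeight ε) (hμ : IsWeight μ) (a b : ℝ) {x : ℝ}
    (hx : |x| ≤ 1) :
    Continuous (fun E => solU ε μ a b E x) ∧ Continuous fun E => solV ε μ a b E x := by
  have key : ∀ E A B : ℝ, Tendsto (fun F => (F - E) *
      (A * (∫ t in (0 : ℝ)..x, ε t * (solU ε μ 0 1 E t * solU ε μ a b F t)) -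
        B * ∫ t in (0 : ℝ)..x, ε t * (solU ε μ 1 0 E t * solU ε μ a b F t))) (𝓝 E) (𝓝 0) := by
    intro E A B
    obtain ⟨M, hM⟩ := exists_abs_integral_le hε hμ a b 0 1 E hx
    obtain ⟨M', hM'⟩ := exists_abs_integral_le hε hμ a b 1 0 E hx
    refine tendsto_sub_mul_of_bounded (M := |A| * M + |B| * M') fun F hF => ?_
    refine (abs_sub _ _).trans ?_
    rw [abs_mul, abs_mul]
    have h1 := hM F hF
    have h2 := hM' F hF
    gcongr
  refine ⟨continuous_iff_continuousAt.2 fun E => ?_, continuous_iff_continuousAt.2 fun E => ?_⟩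
  · have := (key E (solU ε μ 1 0 E x) (solU ε μ 0 1 E x)).const_add (solU ε μ a b E x)
    simp_rw [← (sol_eq_add hε hμ a b E _ x).1, add_zero] at this
    exact this
  · have := (key E (solV ε μ 1 0 E x) (solV ε μ 0 1 E x)).const_add (solV ε μ a b E x)
    simp_rw [← (sol_eq_add hε hμ a b E _ x).2, add_zero] at this
    exact this

theorem continuous_integral_energy (hε : IsWeight ε) (hμ : IsWeight μ) (a b a' b' E : ℝ) {x : ℝ}
    (hx : |x| ≤ 1) : ContinuousAt
      (fun F => ∫ t in (0 : ℝ)..x, ε t * (solU ε μ a' b' E t * solU ε μ a b F t)) E := by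
  obtain ⟨K, hK, hεK⟩ := hε.exists_abs_le
  obtain ⟨M, hM⟩ := exists_abs_sol_le hε hμ a b (|E| + 1) (by positivity)
  obtain ⟨M', hM'⟩ := exists_abs_sol_le hε hμ a' b' |E| (by positivity)
  have hev : ∀ᶠ F in 𝓝 E, |F| < |E| + 1 :=
    continuous_abs.continuousAt.eventually_lt_const (lt_add_one _)
  have htx : ∀ t ∈ uIoc 0 x, |t| ≤ 1 := fun t ht => by
    have := abs_sub_left_of_mem_uIcc (uIoc_subset_uIcc ht)
    simp only [sub_zero] at this
    exact this.trans hx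
  refine intervalIntegral.continuousAt_of_dominated_interval (bound := fun _ => K * (M' * M))
    (Eventually.of_forall fun F => ?_) ?_ intervalIntegrable_const ?_
  · exact (hε.intervalIntegrable_mul ((isSol_sol hε hμ a' b' E).continuous_fst.mul
      (isSol_sol hε hμ a b F).continuous_fst) 0 x).def'.aestronglyMeasurable
  · filter_upwards [hev] with F hF
    refine Eventually.of_forall fun t ht => ?_
    have h1 := (hM' E le_rfl t (htx t ht)).1
    have h2 := (hM F hF.le t (htx t ht)).1
    have h3 := (abs_nonneg _).trans h1
    rw [Real.norm_eq_abs, abs_mul, abs_mul]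
    have := hεK t
    gcongr
  · refine Eventually.of_forall fun t ht => ?_
    exact ((continuous_sol_energy hε hμ a b (htx t ht)).1.continuousAt.const_mul _).const_mul _

theorem hasDerivAt_of_eq_add_mul {f g : ℝ → ℝ} {E : ℝ} (hfg : ∀ F, f F = f E + (F - E) * g F)
    (hg : ContinuousAt g E) : HasDerivAt f (g E) E := by
  rw [hasDerivAt_iff_tendsto_slope]
  refine (hg.tendsto.mono_left nhdsWithin_le_nhds).congr' ?_
  filter_upwards [self_mem_nhdsWithin] with F hF
  rw [slope_def_field, hfg F, add_sub_cancel_left, mul_div_cancel_left₀ _ (sub_ne_zero.2 hF)]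

/-- The derivative of a solution with fixed initial values with respect to the energy. -/
theorem hasDerivAt_sol_energy (hε : IsWeight ε) (hμ : IsWeight μ) (a b E : ℝ) {x : ℝ}
    (hx : |x| ≤ 1) :
    HasDerivAt (fun F => solU ε μ a b F x)
      (solU ε μ 1 0 E x * (∫ t in (0 : ℝ)..x, ε t * (solU ε μ 0 1 E t * solU ε μ a b E t)) -
        solU ε μ 0 1 E x * ∫ t in (0 : ℝ)..x, ε t * (solU ε μ 1 0 E t * solU ε μ a b E t)) E ∧
    HasDerivAt (fun F => solV ε μ a b F x)
      (solV ε μ 1 0 E x * (∫ t in (0 : ℝ)..x, ε t * (solU ε μ 0 1 E t * solU ε μ a b E t)) -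
        solV ε μ 0 1 E x * ∫ t in (0 : ℝ)..x, ε t * (solU ε μ 1 0 E t * solU ε μ a b E t)) E := by
  have h0 := continuous_integral_energy hε hμ a b 0 1 E hx
  have h1 := continuous_integral_energy hε hμ a b 1 0 E hx
  exact ⟨hasDerivAt_of_eq_add_mul (fun F => (sol_eq_add hε hμ a b E F x).1)
      ((h0.const_mul _).sub (h1.const_mul _)),
    hasDerivAt_of_eq_add_mul (fun F => (sol_eq_add hε hμ a b E F x).2)
      ((h0.const_mul _).sub (h1.const_mul _))⟩

/-! ### Oscillation at high energy -/

theorem IsSol.neg {E : ℝ} {u v : ℝ → ℝ} (h : IsSol ε μ E u v) :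
    IsSol ε μ E (fun x => -u x) fun x => -v x := by
  refine ⟨h.continuous_fst.neg, h.continuous_snd.neg, fun a b => ?_, fun a b => ?_⟩
  · have := h.fst_sub a b
    simp only [mul_neg, intervalIntegral.integral_neg]
    linarith
  · have := h.snd_sub a b
    simp only [mul_neg, intervalIntegral.integral_neg, neg_neg, neg_mul] at this ⊢
    linarith

/-- A solution that is positive on an interval has small energy. The quasi-derivative `v` of such a
solution decreases, so it has a sign on one side of `c`. On that side `|v|` is at least what the
energy term has contributed, and at most what the positivity of `u` allows. -/
theorem IsSol.energy_le_of_pos {E : ℝ} {u v : ℝ → ℝ} (h : IsSol ε μ E u v) (hε : IsWeight ε)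
    (hμ : IsWeight μ) (hE : 0 ≤ E) {α a c b β : ℝ} (h1 : α ≤ a) (h2 : a ≤ c) (h3 : c ≤ b)
    (h4 : b ≤ β) (hpos : ∀ x ∈ Icc α β, 0 < u x) :
    E * (∫ x in a..c, ε x) * (∫ x in α..a, μ x) ≤ 1 ∨
      E * (∫ x in c..b, ε x) * (∫ x in b..β, μ x) ≤ 1 := by
  have hint := hμ.intervalIntegrable_mul h.continuous_snd
  have hint' := hε.intervalIntegrable_mul (continuous_const.mul h.continuous_fst : Continuous
    ((fun _ => -E) * u))
  have hanti : ∀ x y, α ≤ x → x ≤ y → y ≤ β → v y ≤ v x := by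
    intro x y hx hxy hy
    have : 0 ≤ ∫ t in x..y, -(ε t * (-E * u t)) := by
      refine intervalIntegral.integral_nonneg hxy fun t ht => ?_
      have := hpos t ⟨hx.trans ht.1, ht.2.trans hy⟩
      have := hε.pos t
      simp only [neg_mul, mul_neg, neg_neg]
      positivity
    rw [intervalIntegral.integral_neg, ← h.snd_sub] at this
    linarith
  have hmul : ∀ k : ℝ, Continuous fun _ : ℝ => k := fun k => continuous_const
  rcases le_total 0 (v c) with hc | hc
  -- Here `v ≥ 0` and `u` is nondecreasing on `[α, c]`.
  · left
    have hua := hpos a ⟨h1, by linarith⟩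
    have hm : v a * ∫ x in α..a, μ x ≤ u a := by
      have : ∫ x in α..a, μ x * v a ≤ ∫ x in α..a, μ x * v x := by
        refine intervalIntegral.integral_mono_on h1 (hμ.intervalIntegrable_mul (hmul _) _ _)
          (hint _ _) fun x hx => ?_
        exact mul_le_mul_of_nonneg_left (hanti x a hx.1 hx.2 (by linarith)) (hμ.pos x).le
      rw [← h.fst_sub, intervalIntegral.integral_mul_const] at this
      have := hpos α ⟨le_rfl, by linarith⟩
      linarith
    have he : E * u a * ∫ x in a..c, ε x ≤ v a := by
      have : ∫ x in a..c, ε x * (-E * u x) ≤ ∫ x in a..c, ε x * (-E * u a) := by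
        refine intervalIntegral.integral_mono_on h2 (hint' _ _)
          (hε.intervalIntegrable_mul (hmul _) _ _) fun x hx => ?_
        have hux : u a ≤ u x := by
          have : 0 ≤ ∫ t in a..x, μ t * v t := by
            refine intervalIntegral.integral_nonneg hx.1 fun t ht => ?_
            exact mul_nonneg (hμ.pos t).le
              (hc.trans (hanti t c (h1.trans ht.1) (ht.2.trans hx.2) (by linarith)))
          rw [← h.fst_sub] at this
          linarith
        have := mul_le_mul_of_nonneg_left hux hE
        exact mul_le_mul_of_nonneg_left (by linarith) (hε.pos x).le
      rw [← h.snd_sub, intervalIntegral.integral_mul_const] at this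
      linarith
    have hm0 : 0 ≤ ∫ x in α..a, μ x :=
      intervalIntegral.integral_nonneg h1 fun x _ => (hμ.pos x).le
    have := (mul_le_mul_of_nonneg_right he hm0).trans hm
    refine le_of_mul_le_mul_right ?_ hua
    linarith
  -- Here `v ≤ 0` and `u` is nonincreasing on `[c, β]`.
  · right
    have hub := hpos b ⟨by linarith, h4⟩
    have hm : -v b * ∫ x in b..β, μ x ≤ u b := by
      have : ∫ x in b..β, μ x * v x ≤ ∫ x in b..β, μ x * v b := by
        refine intervalIntegral.integral_mono_on h4 (hint _ _)
          (hμ.intervalIntegrable_mul (hmul _) _ _) fun x hx => ?_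
        exact mul_le_mul_of_nonneg_left (hanti b x (by linarith) hx.1 hx.2) (hμ.pos x).le
      rw [← h.fst_sub, intervalIntegral.integral_mul_const] at this
      have := hpos β ⟨by linarith, le_rfl⟩
      linarith
    have he : E * u b * ∫ x in c..b, ε x ≤ -v b := by
      have : ∫ x in c..b, ε x * (-E * u x) ≤ ∫ x in c..b, ε x * (-E * u b) := by
        refine intervalIntegral.integral_mono_on h3 (hint' _ _)
          (hε.intervalIntegrable_mul (hmul _) _ _) fun x hx => ?_
        have hux : u b ≤ u x := by
          have : 0 ≤ ∫ t in x..b, -(μ t * v t) := by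
            refine intervalIntegral.integral_nonneg hx.2 fun t ht => ?_
            have h5 := (hanti c t (by linarith) (hx.1.trans ht.1) (ht.2.trans h4)).trans hc
            have := mul_nonneg (hμ.pos t).le (neg_nonneg.2 h5)
            linarith
          rw [intervalIntegral.integral_neg, ← h.fst_sub] at this
          linarith
        have := mul_le_mul_of_nonneg_left hux hE
        exact mul_le_mul_of_nonneg_left (by linarith) (hε.pos x).le
      rw [← h.snd_sub, intervalIntegral.integral_mul_const] at this
      linarith
    have hm0 : 0 ≤ ∫ x in b..β, μ x :=
      intervalIntegral.integral_nonneg h4 fun x _ => (hμ.pos x).le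
    have := (mul_le_mul_of_nonneg_right he hm0).trans hm
    refine le_of_mul_le_mul_right ?_ hub
    linarith

/-- At high energy every solution vanishes somewhere in a given interval. -/
theorem exists_zero_of_energy_ge (hε : IsWeight ε) (hμ : IsWeight μ) {α β : ℝ} (hαβ : α < β) :
    ∃ T, ∀ E, T ≤ E → ∀ u v, IsSol ε μ E u v → ∃ x ∈ Icc α β, u x = 0 := by
  obtain ⟨c, hαc, hcβ⟩ := exists_between hαβ
  obtain ⟨a, hαa, hac⟩ := exists_between hαc
  obtain ⟨b, hcb, hbβ⟩ := exists_between hcβ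
  have e1 := mul_pos (hε.integral_pos hac) (hμ.integral_pos hαa)
  have e2 := mul_pos (hε.integral_pos hcb) (hμ.integral_pos hbβ)
  set p := (∫ x in a..c, ε x) * ∫ x in α..a, μ x
  set q := (∫ x in c..b, ε x) * ∫ x in b..β, μ x
  refine ⟨2 / p + 2 / q, fun E hE u v h => ?_⟩
  have hp : 0 < 2 / p := by positivity
  have hq : 0 < 2 / q := by positivity
  have key : ∀ u v, IsSol ε μ E u v → ¬ ∀ x ∈ Icc α β, 0 < u x := by
    intro u v h hpos
    rcases h.energy_le_of_pos hε hμ (by linarith) hαa.le hac.le hcb.le hbβ.le hpos with h' | h'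
    · have : 2 / p * p ≤ E * p := mul_le_mul_of_nonneg_right (by linarith) e1.le
      rw [div_mul_cancel₀ _ e1.ne'] at this
      rw [mul_assoc] at h'
      linarith
    · have : 2 / q * q ≤ E * q := mul_le_mul_of_nonneg_right (by linarith) e2.le
      rw [div_mul_cancel₀ _ e2.ne'] at this
      rw [mul_assoc] at h'
      linarith
  by_contra! hne
  have hα := hne α (left_mem_Icc.2 hαβ.le)
  have hconn := isPreconnected_Icc (a := α) (b := β)
  -- By continuity `u` keeps its sign; if it is negative, `-u` is a positive solution.
  rcases hα.lt_or_gt with hneg | hpos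
  · refine key _ _ h.neg fun x hx => ?_
    by_contra hx'
    obtain ⟨y, hy, hy0⟩ := hconn.intermediate_value (left_mem_Icc.2 hαβ.le) hx
      h.continuous_fst.continuousOn ⟨hneg.le, by simpa using hx'⟩
    exact hne y hy hy0
  · refine key _ _ h fun x hx => ?_
    by_contra hx'
    obtain ⟨y, hy, hy0⟩ := hconn.intermediate_value hx (left_mem_Icc.2 hαβ.le)
      h.continuous_fst.continuousOn ⟨not_lt.1 hx', hpos.le⟩
    exact hne y hy hy0

/-! ### The Prüfer angle -/

theorem sq_add_sq_pos (hε : IsWeight ε) (hμ : IsWeight μ) (E x : ℝ) :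
    0 < solU ε μ 1 0 E x ^ 2 + solV ε μ 1 0 E x ^ 2 := by
  have hw := wronskian_eq_one hε hμ E x
  by_contra! hle
  have h1 : solU ε μ 1 0 E x = 0 := by
    nlinarith [sq_nonneg (solU ε μ 1 0 E x), sq_nonneg (solV ε μ 1 0 E x)]
  have h2 : solV ε μ 1 0 E x = 0 := by
    nlinarith [sq_nonneg (solU ε μ 1 0 E x), sq_nonneg (solV ε μ 1 0 E x)]
  simp [h1, h2] at hw

/-- The density of the Prüfer angle. -/
def pruferDensity (ε μ : ℝ → ℝ) (E x : ℝ) : ℝ :=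
  μ x * (solV ε μ 1 0 E x ^ 2 / (solU ε μ 1 0 E x ^ 2 + solV ε μ 1 0 E x ^ 2)) +
    ε x * (E * (solU ε μ 1 0 E x ^ 2 / (solU ε μ 1 0 E x ^ 2 + solV ε μ 1 0 E x ^ 2)))

/-- The Prüfer angle `θ` of the solution with `(u, v)(0) = (1, 0)`: the continuous choice of the
angle for which `(u, v)` is a positive multiple of `(cos θ, -sin θ)`, written as the integral of its
derivative. -/
def prufer (ε μ : ℝ → ℝ) (E x : ℝ) : ℝ := ∫ t in (0 : ℝ)..x, pruferDensity ε μ E t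

theorem continuous_div_sq_add_sq (hε : IsWeight ε) (hμ : IsWeight μ) (E : ℝ) :
    Continuous (fun x => solV ε μ 1 0 E x ^ 2 / (solU ε μ 1 0 E x ^ 2 + solV ε μ 1 0 E x ^ 2)) ∧
    Continuous fun x => E *
      (solU ε μ 1 0 E x ^ 2 / (solU ε μ 1 0 E x ^ 2 + solV ε μ 1 0 E x ^ 2)) := by
  have hs := isSol_sol hε hμ 1 0 E
  have hu := hs.continuous_fst
  have hv := hs.continuous_snd
  exact ⟨(hv.pow 2).div ((hu.pow 2).add (hv.pow 2)) fun x => (sq_add_sq_pos hε hμ E x).ne',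
    continuous_const.mul ((hu.pow 2).div ((hu.pow 2).add (hv.pow 2)) fun x =>
      (sq_add_sq_pos hε hμ E x).ne')⟩

theorem intervalIntegrable_pruferDensity (hε : IsWeight ε) (hμ : IsWeight μ) (E a b : ℝ) :
    IntervalIntegrable (pruferDensity ε μ E) volume a b :=
  (hμ.intervalIntegrable_mul (continuous_div_sq_add_sq hε hμ E).1 a b).add
    (hε.intervalIntegrable_mul (continuous_div_sq_add_sq hε hμ E).2 a b)

theorem prufer_sub (hε : IsWeight ε) (hμ : IsWeight μ) (E a b : ℝ) :
    prufer ε μ E b - prufer ε μ E a = ∫ t in a..b, pruferDensity ε μ E t :=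
  intervalIntegral.integral_interval_sub_left (intervalIntegrable_pruferDensity hε hμ E 0 b)
    (intervalIntegrable_pruferDensity hε hμ E 0 a)

theorem prufer_strictMono (hε : IsWeight ε) (hμ : IsWeight μ) {E : ℝ} (hE : 0 < E) :
    StrictMono (prufer ε μ E) := by
  intro a b hab
  rw [← sub_pos, prufer_sub hε hμ]
  refine intervalIntegral.intervalIntegral_pos_of_pos_on
    (intervalIntegrable_pruferDensity hε hμ E a b) (fun x _ => ?_) hab
  have h := sq_add_sq_pos hε hμ E x
  have h1 := hε.pos x
  have h2 := hμ.pos x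
  rw [pruferDensity]
  rcases eq_or_ne (solV ε μ 1 0 E x) 0 with hv | hv
  · have : 0 < solU ε μ 1 0 E x ^ 2 := by simpa [hv] using h
    positivity
  · positivity

/-- `(u, v)` is a multiple of `(cos θ, -sin θ)`, because `Z = u sin θ + v cos θ` satisfies a
homogeneous linear equation `Z' = h Z` with bounded `h` and vanishes at `0`. -/
theorem sin_prufer_add_cos_prufer (hε : IsWeight ε) (hμ : IsWeight μ) (E : ℝ) {x : ℝ}
    (hx : 0 ≤ x) :
    solU ε μ 1 0 E x * Real.sin (prufer ε μ E x) +
      solV ε μ 1 0 E x * Real.cos (prufer ε μ E x) = 0 := by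
  obtain ⟨K, hK, hεK⟩ := hε.exists_abs_le
  obtain ⟨L, hL, hμL⟩ := hμ.exists_abs_le
  have hs := isSol_sol hε hμ 1 0 E
  have hθ : HasACDeriv (prufer ε μ E) (pruferDensity ε μ E) 0 x :=
    HasACDeriv.of_integral (intervalIntegrable_pruferDensity hε hμ E) (prufer_sub hε hμ E) 0 x
  have hsin := hθ.comp_lipschitz Real.lipschitzWith_sin Real.hasDerivAt_sin
  have hcos := hθ.comp_lipschitz Real.lipschitzWith_cos Real.hasDerivAt_cos
  set Z : ℝ → ℝ := fun t => solU ε μ 1 0 E t * Real.sin (prufer ε μ E t) +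
    solV ε μ 1 0 E t * Real.cos (prufer ε μ E t)
  set h : ℝ → ℝ := fun t => (μ t - E * ε t) *
    (solU ε μ 1 0 E t * solV ε μ 1 0 E t / (solU ε μ 1 0 E t ^ 2 + solV ε μ 1 0 E t ^ 2))
  have hZ : HasACDeriv Z (fun t => h t * Z t) 0 x := by
    refine (((hs.hasACDeriv_fst hμ 0 x).mul hsin).add
      ((hs.hasACDeriv_snd hε 0 x).mul hcos)).congr_deriv (Eventually.of_forall fun t _ => ?_)
    have hρ := (sq_add_sq_pos hε hμ E t).ne'
    simp only [pruferDensity, h, Z]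
    field_simp
    ring
  have hexp : HasACDeriv (fun t => Real.exp (-(2 * (L + K * |E|)) * t))
      (fun t => Real.exp (-(2 * (L + K * |E|)) * t) * -(2 * (L + K * |E|))) 0 x := by
    refine HasACDeriv.of_hasDerivAt (by fun_prop) (fun t => ?_) 0 x
    simpa using ((hasDerivAt_id t).const_mul (-(2 * (L + K * |E|)))).exp
  have hmain := ((hZ.mul hZ).mul hexp).congr_deriv (g' := fun t =>
    -(2 * Real.exp (-(2 * (L + K * |E|)) * t) * Z t ^ 2 * ((L + K * |E|) - h t)))
    (Eventually.of_forall fun t _ => by ring) |>.integral_eq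
  -- `L + K |E|` bounds `h`, so the weight makes `Z²` times the exponential nonincreasing.
  have hneg : 0 ≤ ∫ t in (0 : ℝ)..x,
      2 * Real.exp (-(2 * (L + K * |E|)) * t) * Z t ^ 2 * ((L + K * |E|) - h t) := by
    refine intervalIntegral.integral_nonneg hx fun t _ => ?_
    have hρ := sq_add_sq_pos hε hμ E t
    have hq : |solU ε μ 1 0 E t * solV ε μ 1 0 E t /
        (solU ε μ 1 0 E t ^ 2 + solV ε μ 1 0 E t ^ 2)| ≤ 1 := by
      rw [abs_div, abs_of_pos hρ, div_le_one hρ, abs_le]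
      constructor <;> nlinarith [sq_nonneg (solU ε μ 1 0 E t + solV ε μ 1 0 E t),
        sq_nonneg (solU ε μ 1 0 E t - solV ε μ 1 0 E t)]
    have hb : h t ≤ L + K * |E| := by
      refine (le_abs_self _).trans ?_
      rw [abs_mul]
      have h1 : |μ t - E * ε t| ≤ L + K * |E| := by
        refine (abs_sub _ _).trans (add_le_add (hμL t) ?_)
        rw [abs_mul, mul_comm]
        exact mul_le_mul_of_nonneg_right (hεK t) (abs_nonneg E)
      exact (mul_le_of_le_one_right (abs_nonneg _) hq).trans h1
    have := sub_nonneg.2 hb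
    positivity
  have hZ0 : Z 0 = 0 := by simp [Z, prufer, solV_zero]
  rw [intervalIntegral.integral_neg, hZ0] at hmain
  have hle : Z x * Z x * Real.exp (-(2 * (L + K * |E|)) * x) ≤ 0 := by linarith
  exact mul_self_eq_zero.1 (le_antisymm (nonpos_of_mul_nonpos_left hle (Real.exp_pos _))
    (mul_self_nonneg _))

/-- Successive zeros of `u` increase the Prüfer angle by at least `π`. -/
theorem exists_zero_prufer_ge (hε : IsWeight ε) (hμ : IsWeight μ) (n : ℕ) {β : ℝ} (hβ : 0 < β) :
    ∃ T, 0 < T ∧ ∀ E, T ≤ E → ∃ x ∈ Icc 0 β, solU ε μ 1 0 E x = 0 ∧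
      n * Real.pi ≤ prufer ε μ E x := by
  induction n generalizing β with
  | zero =>
    obtain ⟨T, hT⟩ := exists_zero_of_energy_ge hε hμ hβ
    refine ⟨max T 1, by positivity, fun E hE => ?_⟩
    obtain ⟨x, hx, hx0⟩ := hT E ((le_max_left _ _).trans hE) _ _ (isSol_sol hε hμ 1 0 E)
    refine ⟨x, hx, hx0, ?_⟩
    have hE0 : 0 < E := one_pos.trans_le ((le_max_right _ _).trans hE)
    have := (prufer_strictMono hε hμ hE0).monotone hx.1
    simpa [prufer] using this
  | succ n ih =>
    obtain ⟨T₁, hT₁, h₁⟩ := ih (half_pos hβ)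
    obtain ⟨T₂, h₂⟩ := exists_zero_of_energy_ge hε hμ (show 2 * β / 3 < β by linarith)
    refine ⟨max T₁ T₂, hT₁.trans_le (le_max_left _ _), fun E hE => ?_⟩
    have hE0 : 0 < E := hT₁.trans_le ((le_max_left _ _).trans hE)
    obtain ⟨x, hx, hx0, hxn⟩ := h₁ E ((le_max_left _ _).trans hE)
    obtain ⟨y, hy, hy0⟩ := h₂ E ((le_max_right _ _).trans hE) _ _ (isSol_sol hε hμ 1 0 E)
    have hxy : x < y := hx.2.trans_lt (lt_of_lt_of_le (by linarith) hy.1)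
    refine ⟨y, ⟨by linarith [hx.1], hy.2⟩, hy0, ?_⟩
    have hcos : ∀ z, 0 ≤ z → solU ε μ 1 0 E z = 0 → Real.cos (prufer ε μ E z) = 0 := by
      intro z hz hz0
      have h := sin_prufer_add_cos_prufer hε hμ E hz
      have hw := wronskian_eq_one hε hμ E z
      rw [hz0] at h hw
      simp only [zero_mul, zero_add] at h
      refine (mul_eq_zero.1 h).resolve_left fun hv => ?_
      simp [hv] at hw
    obtain ⟨k, hk⟩ := Real.cos_eq_zero_iff.1 (hcos x hx.1 hx0)
    obtain ⟨l, hl⟩ := Real.cos_eq_zero_iff.1 (hcos y (by linarith [hx.1]) hy0)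
    have hlt := prufer_strictMono hε hμ hE0 hxy
    have hkl : k + 1 ≤ l := by
      by_contra! hlk
      have : (l : ℝ) ≤ k := by exact_mod_cast Int.lt_add_one_iff.1 hlk
      rw [hk, hl] at hlt
      nlinarith [Real.pi_pos]
    have hkl' : (k : ℝ) + 1 ≤ l := by exact_mod_cast hkl
    rw [hk] at hxn
    rw [hl]
    push_cast
    nlinarith [Real.pi_pos]

theorem continuous_prufer_energy (hε : IsWeight ε) (hμ : IsWeight μ) {x : ℝ} (hx : |x| ≤ 1) :
    Continuous fun E => prufer ε μ E x := by
  obtain ⟨K, hK, hεK⟩ := hε.exists_abs_le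
  obtain ⟨L, hL, hμL⟩ := hμ.exists_abs_le
  rw [continuous_iff_continuousAt]
  intro E
  have hev : ∀ᶠ F in 𝓝 E, |F| < |E| + 1 :=
    continuous_abs.continuousAt.eventually_lt_const (lt_add_one _)
  refine intervalIntegral.continuousAt_of_dominated_interval
    (bound := fun _ => L * 1 + K * ((|E| + 1) * 1)) (Eventually.of_forall fun F => ?_) ?_
    intervalIntegrable_const ?_
  · exact (intervalIntegrable_pruferDensity hε hμ F 0 x).def'.aestronglyMeasurable
  · filter_upwards [hev] with F hF
    refine Eventually.of_forall fun t _ => ?_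
    have hρ := sq_add_sq_pos hε hμ F t
    have h1 : |solV ε μ 1 0 F t ^ 2 / (solU ε μ 1 0 F t ^ 2 + solV ε μ 1 0 F t ^ 2)| ≤ 1 := by
      rw [abs_div, abs_of_pos hρ, div_le_one hρ, abs_of_nonneg (sq_nonneg _)]
      exact le_add_of_nonneg_left (sq_nonneg _)
    have h2 : |solU ε μ 1 0 F t ^ 2 / (solU ε μ 1 0 F t ^ 2 + solV ε μ 1 0 F t ^ 2)| ≤ 1 := by
      rw [abs_div, abs_of_pos hρ, div_le_one hρ, abs_of_nonneg (sq_nonneg _)]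
      exact le_add_of_nonneg_right (sq_nonneg _)
    have h3 := hμL t
    have h4 := hεK t
    refine (abs_add_le _ _).trans ?_
    rw [abs_mul, abs_mul, abs_mul]
    gcongr
  · refine Eventually.of_forall fun t ht => ?_
    have htx : |t| ≤ 1 := by
      have := abs_sub_left_of_mem_uIcc (uIoc_subset_uIcc ht)
      simp only [sub_zero] at this
      exact this.trans hx
    have hu := (continuous_sol_energy hε hμ 1 0 htx).1
    have hv := (continuous_sol_energy hε hμ 1 0 htx).2
    have hρ : ∀ F, solU ε μ 1 0 F t ^ 2 + solV ε μ 1 0 F t ^ 2 ≠ 0 := fun F =>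
      (sq_add_sq_pos hε hμ F t).ne'
    exact ((((hv.pow 2).div ((hu.pow 2).add (hv.pow 2)) hρ).const_mul _).add
      ((continuous_id.mul ((hu.pow 2).div ((hu.pow 2).add (hv.pow 2)) hρ)).const_mul
        _)).continuousAt

/-- Since the Prüfer angle at a point `x > 0` tends to infinity with the energy, `u` and `v`
alternately vanish at `x` for arbitrarily high energies. -/
theorem exists_energy_zeros (hε : IsWeight ε) (hμ : IsWeight μ) {x : ℝ} (hx0 : 0 < x)
    (hx1 : x ≤ 1) (T : ℝ) :
    ∃ t t', T < t ∧ t < t' ∧ solU ε μ 1 0 t x = 0 ∧ solV ε μ 1 0 t' x = 0 := by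
  have hcont := continuous_prufer_energy hε hμ (x := x) (by rwa [abs_of_pos hx0])
  have hlarge : ∀ (A : ℝ) (S : ℝ), ∃ E, S < E ∧ A < prufer ε μ E x := by
    intro A S
    obtain ⟨n, hn⟩ := exists_nat_gt (A / Real.pi)
    rw [div_lt_iff₀ Real.pi_pos] at hn
    obtain ⟨T', hT', h⟩ := exists_zero_prufer_ge hε hμ n hx0
    have hE : T' ≤ max T' (S + 1) := le_max_left _ _
    obtain ⟨y, hy, -, hyn⟩ := h _ hE
    have := (prufer_strictMono hε hμ (hT'.trans_le hE)).monotone hy.2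
    exact ⟨_, (lt_add_one S).trans_le (le_max_right _ _), by linarith⟩
  have hivt : ∀ A S, prufer ε μ S x < A → ∃ E, S < E ∧ prufer ε μ E x = A := by
    intro A S hS
    obtain ⟨E', hE', hA⟩ := hlarge A S
    obtain ⟨E, hE, hEA⟩ := intermediate_value_Ioo hE'.le hcont.continuousOn ⟨hS, hA⟩
    exact ⟨E, hE.1, hEA⟩
  obtain ⟨n, hn⟩ := exists_nat_gt (prufer ε μ T x / Real.pi)
  rw [div_lt_iff₀ Real.pi_pos] at hn
  have hpi := Real.pi_pos
  obtain ⟨t, htT, ht⟩ := hivt (n * Real.pi + Real.pi / 2) T (by linarith)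
  obtain ⟨t', htt', ht'⟩ := hivt ((n + 1 : ℕ) * Real.pi) t (by rw [ht]; push_cast; linarith)
  refine ⟨t, t', htT, htt', ?_, ?_⟩
  · have h := sin_prufer_add_cos_prufer hε hμ t hx0.le
    have hc : Real.cos (n * Real.pi + Real.pi / 2) = 0 := by
      rw [Real.cos_add_pi_div_two, Real.sin_nat_mul_pi, neg_zero]
    have hs := Real.sin_sq_add_cos_sq (n * Real.pi + Real.pi / 2)
    rw [ht, hc, mul_zero, add_zero] at h
    refine (mul_eq_zero.1 h).resolve_right fun h0 => ?_
    simp [h0, hc] at hs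
  · have h := sin_prufer_add_cos_prufer hε hμ t' hx0.le
    have hs := Real.sin_sq_add_cos_sq ((n + 1 : ℕ) * Real.pi)
    rw [ht', Real.sin_nat_mul_pi, mul_zero, zero_add] at h
    refine (mul_eq_zero.1 h).resolve_right fun h0 => ?_
    simp only [Real.sin_nat_mul_pi, h0] at hs
    norm_num at hs

/-! ### Symmetric unit cells -/

/-- The properties of the coefficients that are used: they are weights of period one and agree
almost everywhere with their reflections. -/
structure IsSymmetricCell (ε μ : ℝ → ℝ) : Prop where
  weight_fst : IsWeight ε
  weight_snd : IsWeight μ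
  periodic_fst : Function.Periodic ε 1
  periodic_snd : Function.Periodic μ 1
  even_fst : ∀ᵐ x : ℝ, ε (-x) = ε x
  even_snd : ∀ᵐ x : ℝ, μ (-x) = μ x

theorem integral_mul_comp_neg {ρ f : ℝ → ℝ} (hρ : ∀ᵐ x : ℝ, ρ (-x) = ρ x) (a b : ℝ) :
    ∫ x in a..b, ρ x * f (-x) = -∫ x in (-a)..(-b), ρ x * f x := by
  rw [intervalIntegral.integral_symm (-b) (-a), neg_neg, ← intervalIntegral.integral_comp_neg]
  refine intervalIntegral.integral_congr_ae ?_
  filter_upwards [hρ] with x hx _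
  rw [hx]

theorem integral_mul_comp_add {ρ f : ℝ → ℝ} {c : ℝ} (hρ : Function.Periodic ρ c) (a b : ℝ) :
    ∫ x in a..b, ρ x * f (x + c) = ∫ x in (a + c)..(b + c), ρ x * f x := by
  rw [← intervalIntegral.integral_comp_add_right]
  exact intervalIntegral.integral_congr fun x _ => by simp only [hρ x]

/-- The reflection of a solution is a solution. -/
theorem IsSol.reflect (hs : IsSymmetricCell ε μ) {E : ℝ} {u v : ℝ → ℝ} (h : IsSol ε μ E u v) :
    IsSol ε μ E (fun x => u (-x)) fun x => -v (-x) := by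
  refine ⟨h.continuous_fst.comp continuous_neg, (h.continuous_snd.comp continuous_neg).neg,
    fun a b => ?_, fun a b => ?_⟩
  · simp only [mul_neg, intervalIntegral.integral_neg]
    rw [integral_mul_comp_neg hs.even_snd, neg_neg, h.fst_sub]
  · rw [integral_mul_comp_neg (f := fun x => -E * u x) hs.even_fst, ← h.snd_sub]
    ring

/-- The translate of a solution by a period is a solution. -/
theorem IsSol.translate {c : ℝ} (hε : Function.Periodic ε c) (hμ : Function.Periodic μ c) {E : ℝ}
    {u v : ℝ → ℝ} (h : IsSol ε μ E u v) :
    IsSol ε μ E (fun x => u (x + c)) fun x => v (x + c) := by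
  have hc : Continuous fun x : ℝ => x + c := continuous_add_const c
  refine ⟨h.continuous_fst.comp hc, h.continuous_snd.comp hc, fun a b => ?_, fun a b => ?_⟩
  · rw [integral_mul_comp_add hμ, h.fst_sub]
  · rw [integral_mul_comp_add (f := fun x => -E * u x) hε, ← h.snd_sub]

theorem solU_even (hs : IsSymmetricCell ε μ) (E x : ℝ) :
    solU ε μ 1 0 E (-x) = solU ε μ 1 0 E x := by
  have h := ((isSol_sol hs.weight_fst hs.weight_snd 1 0 E).reflect hs).eq_add hs.weight_fst
    hs.weight_snd x
  simpa [solU_zero, solV_zero] using h.1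

theorem solU_odd (hs : IsSymmetricCell ε μ) (E x : ℝ) :
    solU ε μ 0 1 E (-x) = -solU ε μ 0 1 E x := by
  have h := ((isSol_sol hs.weight_fst hs.weight_snd 0 1 E).reflect hs).eq_add hs.weight_fst
    hs.weight_snd x
  simpa [solU_zero, solV_zero] using h.1

/-- The value of the even solution at the centre `1/2` between two inversion centres. -/
def evenVal (ε μ : ℝ → ℝ) (E : ℝ) : ℝ := solU ε μ 1 0 E (1 / 2)

/-- The quasi-derivative of the even solution at `1/2`. -/
def evenFlux (ε μ : ℝ → ℝ) (E : ℝ) : ℝ := solV ε μ 1 0 E (1 / 2)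

/-- The value of the odd solution at `1/2`. -/
def oddVal (ε μ : ℝ → ℝ) (E : ℝ) : ℝ := solU ε μ 0 1 E (1 / 2)

/-- The quasi-derivative of the odd solution at `1/2`. -/
def oddFlux (ε μ : ℝ → ℝ) (E : ℝ) : ℝ := solV ε μ 0 1 E (1 / 2)

/-- Half of Hill's discriminant, that is, half of the trace of the monodromy matrix of the unit
cell; for a symmetric cell this is the product formula given here, see `sol_one`. -/
def halfDisc (ε μ : ℝ → ℝ) (E : ℝ) : ℝ :=
  evenVal ε μ E * oddFlux ε μ E + evenFlux ε μ E * oddVal ε μ E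

theorem half_wronskian (hs : IsSymmetricCell ε μ) (E : ℝ) :
    evenVal ε μ E * oddFlux ε μ E - evenFlux ε μ E * oddVal ε μ E = 1 :=
  wronskian_eq_one hs.weight_fst hs.weight_snd E (1 / 2)

/-- The monodromy matrix, factorized by means of the reflection `x ↦ 1 - x` of the cell. -/
theorem sol_one (hs : IsSymmetricCell ε μ) (E : ℝ) :
    (solU ε μ 1 0 E 1 = halfDisc ε μ E ∧
      solV ε μ 1 0 E 1 = 2 * evenVal ε μ E * evenFlux ε μ E) ∧
    solU ε μ 0 1 E 1 = 2 * oddVal ε μ E * oddFlux ε μ E ∧ solV ε μ 0 1 E 1 = halfDisc ε μ E := by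
  have key : ∀ a b,
      solU ε μ a b E 1 = solU ε μ a b E (1 / 2) * oddFlux ε μ E +
        solV ε μ a b E (1 / 2) * oddVal ε μ E ∧
      solV ε μ a b E 1 = solU ε μ a b E (1 / 2) * evenFlux ε μ E +
        solV ε μ a b E (1 / 2) * evenVal ε μ E := by
    intro a b
    have h := ((isSol_sol hs.weight_fst hs.weight_snd a b E).reflect hs).translate
      hs.periodic_fst.neg hs.periodic_snd.neg |>.eq_add hs.weight_fst hs.weight_snd (1 / 2)
    have hw := half_wronskian hs E
    have e1 : -((1 : ℝ) / 2 + -1) = 1 / 2 := by norm_num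
    have e2 : -((0 : ℝ) + -1) = 1 := by norm_num
    simp only [e1, e2] at h
    obtain ⟨h1, h2⟩ := h
    simp only [evenVal, evenFlux, oddVal, oddFlux] at hw ⊢
    constructor
    · linear_combination (-solU ε μ a b E 1) * hw - solV ε μ 0 1 E (1 / 2) * h1 +
        solU ε μ 0 1 E (1 / 2) * h2
    · linear_combination (-solV ε μ a b E 1) * hw - solV ε μ 1 0 E (1 / 2) * h1 +
        solU ε μ 1 0 E (1 / 2) * h2
  have hc := key 1 0
  have ho := key 0 1
  simp only [halfDisc, evenVal, evenFlux, oddVal, oddFlux] at hc ho ⊢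
  exact ⟨⟨by linarith, by linarith⟩, by linarith, by linarith⟩

theorem sol_add_one (hs : IsSymmetricCell ε μ) (E x : ℝ) :
    solU ε μ 1 0 E (x + 1) = halfDisc ε μ E * solU ε μ 1 0 E x +
      2 * evenVal ε μ E * evenFlux ε μ E * solU ε μ 0 1 E x ∧
    solU ε μ 0 1 E (x + 1) = 2 * oddVal ε μ E * oddFlux ε μ E * solU ε μ 1 0 E x +
      halfDisc ε μ E * solU ε μ 0 1 E x := by
  obtain ⟨⟨h1, h2⟩, h3, h4⟩ := sol_one hs E
  have h : ∀ a b, _ := fun a b => ((isSol_sol hs.weight_fst hs.weight_snd a b E).translate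
    hs.periodic_fst hs.periodic_snd).eq_add hs.weight_fst hs.weight_snd x
  have hc := (h 1 0).1
  have ho := (h 0 1).1
  simp only [zero_add, h1, h2, h3, h4] at hc ho
  exact ⟨by linarith, by linarith⟩

/-! ### The half-cell data as functions of the energy -/

theorem exists_solU_even_ne_zero (hs : IsSymmetricCell ε μ) (E : ℝ) :
    ∃ x ∈ Ioo (0 : ℝ) (1 / 2), solU ε μ 1 0 E x ≠ 0 := by
  have hc : ContinuousAt (solU ε μ 1 0 E) 0 :=
    (isSol_sol hs.weight_fst hs.weight_snd 1 0 E).continuous_fst.continuousAt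
  have h0 : ∀ᶠ x in 𝓝[>] (0 : ℝ), solU ε μ 1 0 E x ≠ 0 :=
    (hc.eventually_ne (by rw [solU_zero]; exact one_ne_zero)).filter_mono nhdsWithin_le_nhds
  have h1 : ∀ᶠ x in 𝓝[>] (0 : ℝ), x ∈ Ioo (0 : ℝ) (1 / 2) := Ioo_mem_nhdsGT (by norm_num)
  obtain ⟨x, hx, hx'⟩ := (h0.and h1).exists
  exact ⟨x, hx', hx⟩

theorem exists_solU_odd_ne_zero (hs : IsSymmetricCell ε μ) (E : ℝ) :
    ∃ x ∈ Ioo (0 : ℝ) (1 / 2), solU ε μ 0 1 E x ≠ 0 := by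
  by_contra! h
  have h' : ∀ x ∈ Icc (0 : ℝ) (1 / 4), solU ε μ 0 1 E x = 0 := by
    rintro x ⟨hx0, hx1⟩
    rcases hx0.eq_or_lt with rfl | hx0
    · exact solU_zero _ _ _
    · exact h x ⟨hx0, by linarith⟩
  have hsol := isSol_sol hs.weight_fst hs.weight_snd 0 1 E
  have hv : ∀ x ∈ Icc (0 : ℝ) (1 / 4), solV ε μ 0 1 E x = 1 := by
    intro x hx
    have h1 := hsol.snd_sub 0 x
    have h2 : ∫ t in (0 : ℝ)..x, ε t * (-E * solU ε μ 0 1 E t) = ∫ _ in (0 : ℝ)..x, (0 : ℝ) := by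
      refine intervalIntegral.integral_congr fun t ht => ?_
      rw [uIcc_of_le hx.1] at ht
      simp [h' t ⟨ht.1, ht.2.trans hx.2⟩]
    rw [h2, solV_zero, intervalIntegral.integral_zero] at h1
    linarith
  have h3 := hsol.fst_sub 0 (1 / 4)
  have h4 : ∫ t in (0 : ℝ)..(1 / 4), μ t * solV ε μ 0 1 E t = ∫ t in (0 : ℝ)..(1 / 4), μ t := by
    refine intervalIntegral.integral_congr fun t ht => ?_
    rw [uIcc_of_le (by norm_num)] at ht
    simp [hv t ht]
  rw [h4, h' _ ⟨by norm_num, le_rfl⟩, solU_zero] at h3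
  have := hs.weight_snd.integral_pos (show (0 : ℝ) < 1 / 4 by norm_num)
  linarith

/-- The derivatives of the half-cell data with respect to the energy. The positive numbers `A` and
`G` are the squared norms of the even and of the odd solution on the half cell, with weight `ε`, and
`B` is their inner product. -/
theorem exists_hasDerivAt_half (hs : IsSymmetricCell ε μ) (E : ℝ) : ∃ A B G : ℝ, 0 < A ∧ 0 < G ∧
    HasDerivAt (evenVal ε μ) (evenVal ε μ E * B - oddVal ε μ E * A) E ∧
    HasDerivAt (evenFlux ε μ) (evenFlux ε μ E * B - oddFlux ε μ E * A) E ∧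
    HasDerivAt (oddVal ε μ) (evenVal ε μ E * G - oddVal ε μ E * B) E ∧
    HasDerivAt (oddFlux ε μ) (evenFlux ε μ E * G - oddFlux ε μ E * B) E := by
  have hx : |(1 / 2 : ℝ)| ≤ 1 := by rw [abs_of_pos] <;> norm_num
  have hc := hasDerivAt_sol_energy hs.weight_fst hs.weight_snd 1 0 E hx
  have ho := hasDerivAt_sol_energy hs.weight_fst hs.weight_snd 0 1 E hx
  simp_rw [mul_comm (solU ε μ 1 0 E _) (solU ε μ 0 1 E _)] at ho
  obtain ⟨x, hxm, hx0⟩ := exists_solU_even_ne_zero hs E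
  obtain ⟨y, hym, hy0⟩ := exists_solU_odd_ne_zero hs E
  have hcc := (isSol_sol hs.weight_fst hs.weight_snd 1 0 E).continuous_fst
  have hoc := (isSol_sol hs.weight_fst hs.weight_snd 0 1 E).continuous_fst
  exact ⟨_, _, _, hs.weight_fst.integral_mul_pos (hcc.mul hcc) (fun t => mul_self_nonneg _) hxm
      (mul_self_ne_zero.2 hx0),
    hs.weight_fst.integral_mul_pos (hoc.mul hoc) (fun t => mul_self_nonneg _) hym
      (mul_self_ne_zero.2 hy0), hc.1, hc.2, ho.1, ho.2⟩

theorem continuous_half (hs : IsSymmetricCell ε μ) :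
    Continuous (evenVal ε μ) ∧ Continuous (evenFlux ε μ) ∧ Continuous (oddVal ε μ) ∧
      Continuous (oddFlux ε μ) := by
  have hx : |(1 / 2 : ℝ)| ≤ 1 := by rw [abs_of_pos] <;> norm_num
  have hc := continuous_sol_energy hs.weight_fst hs.weight_snd 1 0 hx
  have ho := continuous_sol_energy hs.weight_fst hs.weight_snd 0 1 hx
  exact ⟨hc.1, hc.2, ho.1, ho.2⟩

theorem continuous_halfDisc (hs : IsSymmetricCell ε μ) : Continuous (halfDisc ε μ) := by
  obtain ⟨h1, h2, h3, h4⟩ := continuous_half hs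
  exact (h1.mul h4).add (h2.mul h3)

/-- Energy identity: at negative energy `u v` increases. -/
theorem IsSol.mul_lt_mul_of_energy_neg {E : ℝ} {u v : ℝ → ℝ} (h : IsSol ε μ E u v)
    (hε : IsWeight ε) (hμ : IsWeight μ) (hE : E < 0) {a b x₀ : ℝ} (hx₀ : x₀ ∈ Ioo a b)
    (hne : u x₀ ≠ 0) : u a * v a < u b * v b := by
  have hab : a ≤ b := (hx₀.1.trans hx₀.2).le
  have h1 := ((h.hasACDeriv_fst hμ a b).mul (h.hasACDeriv_snd hε a b)).congr_deriv
    (g' := fun x => μ x * (v x * v x) + -E * (ε x * (u x * u x)))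
    (Eventually.of_forall fun x _ => by ring) |>.integral_eq
  have hi1 : IntervalIntegrable (fun x => μ x * (v x * v x)) volume a b :=
    hμ.intervalIntegrable_mul (h.continuous_snd.mul h.continuous_snd) a b
  have hi2 : IntervalIntegrable (fun x => ε x * (u x * u x)) volume a b :=
    hε.intervalIntegrable_mul (h.continuous_fst.mul h.continuous_fst) a b
  rw [intervalIntegral.integral_add hi1 (hi2.const_mul _),
    intervalIntegral.integral_const_mul] at h1
  have h2 : 0 ≤ ∫ x in a..b, μ x * (v x * v x) :=
    intervalIntegral.integral_nonneg hab fun x _ => mul_nonneg (hμ.pos x).le (mul_self_nonneg _)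
  have h3 : 0 < ∫ x in a..b, ε x * (u x * u x) :=
    hε.integral_mul_pos (h.continuous_fst.mul h.continuous_fst)
      (fun x => mul_self_nonneg (u x)) hx₀ (mul_self_ne_zero.2 hne)
  have h4 := mul_pos (neg_pos.2 hE) h3
  linarith

theorem one_lt_halfDisc_sq_of_neg (hs : IsSymmetricCell ε μ) {E : ℝ} (hE : E < 0) :
    1 < halfDisc ε μ E ^ 2 := by
  obtain ⟨x, hxm, hx0⟩ := exists_solU_even_ne_zero hs E
  obtain ⟨y, hym, hy0⟩ := exists_solU_odd_ne_zero hs E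
  have h1 := (isSol_sol hs.weight_fst hs.weight_snd 1 0 E).mul_lt_mul_of_energy_neg hs.weight_fst
    hs.weight_snd hE hxm hx0
  have h2 := (isSol_sol hs.weight_fst hs.weight_snd 0 1 E).mul_lt_mul_of_energy_neg hs.weight_fst
    hs.weight_snd hE hym hy0
  simp only [solU_zero, solV_zero, mul_zero, zero_mul] at h1 h2
  have hw := half_wronskian hs E
  have h3 := mul_pos h1 h2
  have : halfDisc ε μ E ^ 2 = 1 + 4 * (evenVal ε μ E * evenFlux ε μ E *
      (oddVal ε μ E * oddFlux ε μ E)) := by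
    rw [halfDisc]
    linear_combination (evenVal ε μ E * oddFlux ε μ E - evenFlux ε μ E * oddVal ε μ E + 1) * hw
  rw [this]
  simp only [evenVal, evenFlux, oddVal, oddFlux]
  linarith

/-- Above every energy the half-discriminant takes the value `-1` and, further up, the value `1`. -/
theorem exists_halfDisc_eq_neg_one_eq_one (hs : IsSymmetricCell ε μ) (T : ℝ) :
    ∃ t t', T < t ∧ t < t' ∧ halfDisc ε μ t = -1 ∧ halfDisc ε μ t' = 1 := by
  obtain ⟨t, t', h1, h2, h3, h4⟩ := exists_energy_zeros hs.weight_fst hs.weight_snd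
    (show (0 : ℝ) < 1 / 2 by norm_num) (by norm_num) T
  have hw := half_wronskian hs t
  have hw' := half_wronskian hs t'
  refine ⟨t, t', h1, h2, ?_, ?_⟩
  · rw [halfDisc]
    have h3 : evenVal ε μ t = 0 := h3
    rw [h3] at hw ⊢
    linarith
  · rw [halfDisc]
    have h4 : evenFlux ε μ t' = 0 := h4
    rw [h4] at hw' ⊢
    linarith

/-- The energies at which the half-discriminant takes a given value `κ ∈ [-1, 1]` are isolated.
Write `p, q` and `r, w` for the value and the flux of the even and of the odd solution at `1/2`.
If `|κ| < 1`, the derivative does not vanish; if `κ = ±1`, then the discriminant equals `1 + 2 q r`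
and `-1 + 2 p w`, and the zeros of the factors are simple. -/
theorem eventually_halfDisc_ne (hs : IsSymmetricCell ε μ) {E κ : ℝ} (hκ : |κ| ≤ 1)
    (hE : halfDisc ε μ E = κ) : ∀ᶠ F in 𝓝[≠] E, halfDisc ε μ F ≠ κ := by
  obtain ⟨A, B, G, hA, hG, hp, hq, hr, hw⟩ := exists_hasDerivAt_half hs E
  have hW := half_wronskian hs E
  have hD : HasDerivAt (halfDisc ε μ) _ E := (hp.mul hw).add (hq.mul hr)
  rw [halfDisc] at hE
  have isol : ∀ {f : ℝ → ℝ} {f' : ℝ}, HasDerivAt f f' E → (f E = 0 → f' ≠ 0) →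
      ∀ᶠ F in 𝓝[≠] E, f F ≠ 0 := by
    intro f f' hf hf'
    rcases eq_or_ne (f E) 0 with h0 | h0
    · exact hf.eventually_ne (hf' h0)
    · exact (hf.continuousAt.eventually_ne h0).filter_mono nhdsWithin_le_nhds
  rcases eq_or_ne κ 1 with rfl | h1
  · have e1 := isol hq fun h => by
      have : oddFlux ε μ E ≠ 0 := by rintro h'; rw [h, h'] at hW; norm_num at hW
      rw [h, zero_mul, zero_sub]
      exact neg_ne_zero.2 (mul_ne_zero this hA.ne')
    have e2 := isol hr fun h => by
      have : evenVal ε μ E ≠ 0 := by rintro h'; rw [h, h'] at hW; norm_num at hW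
      rw [h, zero_mul, sub_zero]
      exact mul_ne_zero this hG.ne'
    filter_upwards [e1, e2] with F h1 h2 h3
    have := half_wronskian hs F
    rw [halfDisc] at h3
    exact mul_ne_zero h1 h2 (by linarith)
  rcases eq_or_ne κ (-1) with rfl | h2
  · have e1 := isol hp fun h => by
      have : oddVal ε μ E ≠ 0 := by rintro h'; rw [h, h'] at hW; norm_num at hW
      rw [h, zero_mul, zero_sub]
      exact neg_ne_zero.2 (mul_ne_zero this hA.ne')
    have e2 := isol hw fun h => by
      have : evenFlux ε μ E ≠ 0 := by rintro h'; rw [h, h'] at hW; norm_num at hW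
      rw [h, zero_mul, sub_zero]
      exact mul_ne_zero this hG.ne'
    filter_upwards [e1, e2] with F h1 h2 h3
    have := half_wronskian hs F
    rw [halfDisc] at h3
    exact mul_ne_zero h1 h2 (by linarith)
  · refine hD.eventually_ne ?_
    have hlt1 : κ < 1 := lt_of_le_of_ne (abs_le.1 hκ).2 h1
    have hlt2 : -1 < κ := lt_of_le_of_ne (abs_le.1 hκ).1 h2.symm
    set p := evenVal ε μ E
    set q := evenFlux ε μ E
    set r := oddVal ε μ E
    set w := oddFlux ε μ E
    -- `p w > 0 > q r`, so `p q` and `r w` have opposite signs.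
    have hpw : 0 < p * w := by linarith
    have hqr : q * r < 0 := by linarith
    have hprod : (p * q) * (r * w) < 0 := by
      have := mul_neg_of_pos_of_neg hpw hqr
      linarith
    have hval : (p * B - r * A) * w + p * (q * G - w * B) +
        ((q * B - w * A) * r + q * (p * G - r * B)) = 2 * (p * q * G - r * w * A) := by ring
    rw [hval]
    rcases lt_or_gt_of_ne (left_ne_zero_of_mul hprod.ne) with h | h
    · have h' : 0 < r * w := by by_contra! h''; nlinarith
      have := mul_pos h' hA
      have := mul_neg_of_neg_of_pos h hG
      linarith
    · have h' : r * w < 0 := by by_contra! h''; nlinarith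
      have := mul_neg_of_neg_of_pos h' hA
      have := mul_pos h hG
      intro h0
      linarith

/-! ### Inversion symmetry of the coefficients -/

theorem IsPhotonic.isWeight_permittivity (h : IsPhotonic ε μ) : IsWeight ε :=
  ⟨h.piecewise_permittivity.aestronglyMeasurable, h.pos_permittivity,
    h.piecewise_permittivity.bddAbove h.periodic_permittivity⟩

theorem IsPhotonic.isWeight_permeability (h : IsPhotonic ε μ) : IsWeight μ :=
  ⟨h.piecewise_permeability.aestronglyMeasurable, h.pos_permeability,
    h.piecewise_permeability.bddAbove h.periodic_permeability⟩

theorem ae_comp_neg {p : ℝ → Prop} (h : ∀ᵐ x : ℝ, p x) : ∀ᵐ x : ℝ, p (-x) :=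
  (Measure.measurePreserving_neg (volume : Measure ℝ)).quasiMeasurePreserving.ae h

/-- The almost everywhere equations of an element of the graph of `L` hold on the whole line. -/
theorem ae_hasDerivAt_of_forall_solvesOn {u v f : ℝ → ℂ}
    (h : ∀ a b : ℝ, a ≤ b → SolvesOn ε μ a b u v f) :
    ∀ᵐ x : ℝ, HasDerivAt u ((μ x : ℂ) * v x) x ∧ HasDerivAt v (-((ε x : ℂ) * f x)) x := by
  have := ae_all_iff.2 fun n : ℕ => (h (-(n : ℝ)) n (by simp)).2.2
  filter_upwards [this] with x hx
  obtain ⟨n, hn⟩ := exists_nat_ge |x|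
  exact hx n (abs_le.1 hn)

/-- Real functions `ψ`, `w`, `g` with `ψ' = μ w` and `w' = -ε g` define an element of the graph. -/
theorem solvesOn_ofReal {ψ w g : ℝ → ℝ} {a b : ℝ} (hab : a ≤ b)
    (hψ : HasACDeriv ψ (fun x => μ x * w x) a b)
    (hw : HasACDeriv w (fun x => -(ε x * g x)) a b) :
    SolvesOn ε μ a b (fun x => (ψ x : ℂ)) (fun x => (w x : ℂ)) fun x => (g x : ℂ) := by
  refine ⟨hψ.ofReal.1, hw.ofReal.1, ?_⟩
  filter_upwards [hψ.ofReal.2, hw.ofReal.2] with x h1 h2 hx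
  rw [uIcc_of_le hab] at h1 h2
  exact ⟨by simpa using h1 hx, by simpa using h2 hx⟩

/-- If `L` commutes with parity, then `μ` is even: compare `L ψ = 0` and `L (P ψ) = 0` for
`ψ = ∫ μ`. -/
theorem IsPhotonic.even_permeability (h : IsPhotonic ε μ) : ∀ᵐ x : ℝ, μ (-x) = μ x := by
  have hμ := h.isWeight_permeability
  have hψ : ∀ a b, HasACDeriv (fun x => ∫ t in (0 : ℝ)..x, μ t) μ a b :=
    HasACDeriv.of_integral hμ.intervalIntegrable fun a b =>
      intervalIntegral.integral_interval_sub_left (hμ.intervalIntegrable 0 b)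
        (hμ.intervalIntegrable 0 a)
  have hone : ∀ a b, HasACDeriv (fun _ : ℝ => (1 : ℝ)) (fun _ => 0) a b :=
    HasACDeriv.of_hasDerivAt contDiff_const fun x => hasDerivAt_const x 1
  have hg : ∀ a b : ℝ, a ≤ b → SolvesOn ε μ a b (fun x => ((∫ t in (0 : ℝ)..x, μ t : ℝ) : ℂ))
      (fun _ => ((1 : ℝ) : ℂ)) fun _ => ((0 : ℝ) : ℂ) := fun a b hab =>
    solvesOn_ofReal hab ((hψ a b).congr_deriv (Eventually.of_forall fun x _ => by ring))
      ((hone a b).congr_deriv (Eventually.of_forall fun x _ => by ring))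
  obtain ⟨w, hw⟩ := (h.commutes _ _).1 ⟨_, hg⟩
  have hwc : ∀ x, w x = w 0 := by
    intro x
    have key : ∀ a b, a ≤ b → w b = w a := by
      intro a b hab
      refine HasACDeriv.eq_of_deriv_eq_zero (a := a) (b := b) (f' := fun _ => 0)
        ⟨(hw a b hab).2.1, ?_⟩ (Eventually.of_forall fun _ _ => rfl) right_mem_uIcc
      filter_upwards [(hw a b hab).2.2] with y hy hmem
      rw [uIcc_of_le hab] at hmem
      simpa [parityOp] using (hy hmem).2
    rcases le_total 0 x with hx | hx
    · exact key 0 x hx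
    · exact (key x 0 hx).symm
  -- The flux of `P ψ` is a constant, and applying the relation at `x` and at `-x` shows that its
  -- square is one.
  have h1 : ∀ᵐ x : ℝ, -(μ (-x) : ℂ) = μ x * w 0 := by
    filter_upwards [ae_hasDerivAt_of_forall_solvesOn hw,
      ae_comp_neg (ae_hasDerivAt_of_forall_solvesOn hg)] with x hx hx'
    have e1 := hx.1
    have e2 := hx'.1.scomp x (hasDerivAt_neg x)
    rw [hwc x] at e1
    have := e1.unique e2
    rw [this]
    simp
  filter_upwards [h1, ae_comp_neg h1] with x hx hx'
  rw [neg_neg] at hx'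
  have hm : (μ x : ℂ) ≠ 0 := Complex.ofReal_ne_zero.2 (hμ.pos x).ne'
  have hsq : (μ x : ℂ) ^ 2 = (μ (-x) : ℂ) ^ 2 := by
    linear_combination (-(μ x : ℂ)) * hx' + (μ (-x) : ℂ) * hx
  have hsq' : μ x ^ 2 = μ (-x) ^ 2 := by exact_mod_cast hsq
  exact ((sq_eq_sq₀ (hμ.pos x).le (hμ.pos (-x)).le).1 hsq').symm

/-- If `L` commutes with parity, then `ε` is even: compare `L ψ = -1` and `L (P ψ) = -1` for a
`ψ` with `ψ'/μ = ∫ ε`. -/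
theorem IsPhotonic.even_permittivity (h : IsPhotonic ε μ) : ∀ᵐ x : ℝ, ε (-x) = ε x := by
  have hμ := h.isWeight_permeability
  have hε := h.isWeight_permittivity
  have hv : ∀ a b, HasACDeriv (fun x => ∫ t in (0 : ℝ)..x, ε t) ε a b :=
    HasACDeriv.of_integral hε.intervalIntegrable fun a b =>
      intervalIntegral.integral_interval_sub_left (hε.intervalIntegrable 0 b)
        (hε.intervalIntegrable 0 a)
  set v : ℝ → ℝ := fun x => ∫ t in (0 : ℝ)..x, ε t
  have hvc : Continuous v := intervalIntegral.continuous_primitive hε.intervalIntegrable 0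
  have hint := hμ.intervalIntegrable_mul hvc
  have hψ : ∀ a b, HasACDeriv (fun x => ∫ t in (0 : ℝ)..x, μ t * v t) (fun t => μ t * v t) a b :=
    HasACDeriv.of_integral hint fun a b =>
      intervalIntegral.integral_interval_sub_left (hint 0 b) (hint 0 a)
  have hg : ∀ a b : ℝ, a ≤ b → SolvesOn ε μ a b
      (fun x => ((∫ t in (0 : ℝ)..x, μ t * v t : ℝ) : ℂ))
      (fun x => (v x : ℂ)) fun _ => ((-1 : ℝ) : ℂ) := fun a b hab =>
    solvesOn_ofReal hab (hψ a b)
      ((hv a b).congr_deriv (Eventually.of_forall fun x _ => by ring))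
  obtain ⟨w, hw⟩ := (h.commutes _ _).1 ⟨_, hg⟩
  have hwc : Continuous w := by
    rw [continuous_iff_continuousAt]
    intro x
    refine ((hw (x - 1) (x + 1) (by linarith)).2.1.continuousOn).continuousAt ?_
    rw [uIcc_of_le (by linarith)]
    exact Icc_mem_nhds (by linarith) (by linarith)
  have hae := ae_hasDerivAt_of_forall_solvesOn hw
  have haeg := ae_comp_neg (ae_hasDerivAt_of_forall_solvesOn hg)
  have hwv : w = fun x => -(v (-x) : ℂ) := by
    have hae' : w =ᵐ[volume] fun x => -(v (-x) : ℂ) := by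
      filter_upwards [hae, haeg, h.even_permeability] with x hx hx' hμx
      have := hx.1.unique (hx'.1.scomp x (hasDerivAt_neg x))
      rw [hμx] at this
      have hm : (μ x : ℂ) ≠ 0 := Complex.ofReal_ne_zero.2 (hμ.pos x).ne'
      refine mul_left_cancel₀ hm (this.trans ?_)
      simp
    refine Continuous.ae_eq_iff_eq volume hwc ?_ |>.1 hae'
    exact (Complex.continuous_ofReal.comp (hvc.comp continuous_neg)).neg
  filter_upwards [hae, haeg] with x hx hx'
  have e1 := hx.2
  have e2 := (hx'.2.scomp x (hasDerivAt_neg x)).neg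
  have e3 : HasDerivAt w _ x := e2.congr_of_eventuallyEq (Eventually.of_forall fun y => by
    simp [hwv])
  have := e1.unique e3
  simp only [parityOp] at this
  simpa using this.symm

theorem IsPhotonic.isSymmetricCell (h : IsPhotonic ε μ) : IsSymmetricCell ε μ :=
  ⟨h.isWeight_permittivity, h.isWeight_permeability, h.periodic_permittivity,
    h.periodic_permeability, h.even_permittivity, h.even_permeability⟩

/-! ### Bloch modes and the discriminant -/

/-- The complex combination `α c + β s` of the even and the odd fundamental solution. -/
def combo (ε μ : ℝ → ℝ) (E : ℝ) (α β : ℂ) (x : ℝ) : ℂ :=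
  α * solU ε μ 1 0 E x + β * solU ε μ 0 1 E x

/-- `(α, β)` is an eigenvector of the monodromy matrix with eigenvalue `ζ`. -/
def IsMonodromyEigen (ε μ : ℝ → ℝ) (E : ℝ) (ζ α β : ℂ) : Prop :=
  (halfDisc ε μ E - ζ) * α + 2 * oddVal ε μ E * oddFlux ε μ E * β = 0 ∧
    2 * evenVal ε μ E * evenFlux ε μ E * α + (halfDisc ε μ E - ζ) * β = 0

theorem combo_add_one (hs : IsSymmetricCell ε μ) {E : ℝ} {ζ α β : ℂ}
    (h : IsMonodromyEigen ε μ E ζ α β) (x : ℝ) :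
    combo ε μ E α β (x + 1) = ζ * combo ε μ E α β x := by
  obtain ⟨h1, h2⟩ := h
  rw [combo, combo, (sol_add_one hs E x).1, (sol_add_one hs E x).2]
  push_cast
  linear_combination (solU ε μ 1 0 E x : ℂ) * h1 + (solU ε μ 0 1 E x : ℂ) * h2

/-- Two functions that satisfy the same Bloch condition and agree on the unit cell are equal. -/
theorem eq_of_eqOn_cell {ζ : ℂ} (hζ : ‖ζ‖ = 1) {f g : ℝ → ℂ} (hf : ∀ x, f (x + 1) = ζ * f x)
    (hg : ∀ x, g (x + 1) = ζ * g x) (h : ∀ x ∈ Icc (0 : ℝ) 1, f x = g x) : f = g := by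
  have hper : Function.Periodic (fun x => ‖f x - g x‖) 1 := fun x => by
    simp only [hf, hg, ← mul_sub, norm_mul, hζ, one_mul]
  funext x
  obtain ⟨y, hy, hxy⟩ := hper.exists_mem_Ico₀ one_pos x
  simp only [h y (Ico_subset_Icc_self hy), sub_self, norm_zero, norm_eq_zero] at hxy
  exact sub_eq_zero.1 hxy

theorem norm_exp_I_mul (k : ℝ) : ‖Complex.exp (Complex.I * k)‖ = 1 := by
  rw [mul_comm]; exact Complex.norm_exp_ofReal_mul_I k

theorem mem_blochSpace_iff (hs : IsSymmetricCell ε μ) {k E : ℝ} {φ : ℝ → ℂ} :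
    φ ∈ blochSpace ε μ k E ↔
      ∃ α β, IsMonodromyEigen ε μ E (Complex.exp (Complex.I * k)) α β ∧ φ = combo ε μ E α β := by
  obtain ⟨⟨m1, m2⟩, m3, m4⟩ := sol_one hs E
  constructor
  · rintro ⟨hq, v, ⟨hu, hv, hae⟩, hb⟩
    have hy : HasACDeriv φ (fun x => μ x • v x) 0 1 := by
      refine ⟨hu, ?_⟩
      filter_upwards [hae] with x hx hmem
      rw [uIcc_of_le zero_le_one] at hmem
      exact (hx hmem).1
    have hz : HasACDeriv v (fun x => -((E * ε x) • φ x)) 0 1 := by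
      refine ⟨hv, ?_⟩
      filter_upwards [hae] with x hx hmem
      rw [uIcc_of_le zero_le_one] at hmem
      refine (hx hmem).2.congr_deriv ?_
      rw [Complex.real_smul]
      push_cast
      ring
    have hrep := fun {x : ℝ} hx =>
      eq_smul_add_smul hs.weight_fst hs.weight_snd hy hz (x := x) hx
    simp only [Complex.real_smul] at hrep
    have h1 := hrep (x := 1) right_mem_uIcc
    have hq0 := hq 0
    rw [zero_add] at hq0
    rw [hq0, hb, m1, m2, m3, m4] at h1
    push_cast at h1
    have heig : IsMonodromyEigen ε μ E (Complex.exp (Complex.I * k)) (φ 0) (v 0) :=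
      ⟨by linear_combination -h1.1, by linear_combination -h1.2⟩
    refine ⟨φ 0, v 0, heig, eq_of_eqOn_cell (norm_exp_I_mul k) hq (combo_add_one hs heig)
      fun x hx => ?_⟩
    rw [← uIcc_of_le zero_le_one] at hx
    rw [(hrep hx).1, combo]
    ring
  · rintro ⟨α, β, heig, rfl⟩
    have hc := isSol_sol hs.weight_fst hs.weight_snd 1 0 E
    have ho := isSol_sol hs.weight_fst hs.weight_snd 0 1 E
    have hu := ((hc.hasACDeriv_fst hs.weight_snd 0 1).ofReal.const_mul α).add
      ((ho.hasACDeriv_fst hs.weight_snd 0 1).ofReal.const_mul β)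
    have hv := ((hc.hasACDeriv_snd hs.weight_fst 0 1).ofReal.const_mul α).add
      ((ho.hasACDeriv_snd hs.weight_fst 0 1).ofReal.const_mul β)
    refine ⟨combo_add_one hs heig, fun x => α * solV ε μ 1 0 E x + β * solV ε μ 0 1 E x,
      ⟨hu.1, hv.1, ?_⟩, ?_⟩
    · filter_upwards [hu.2, hv.2] with x h1 h2 hx
      rw [← uIcc_of_le zero_le_one] at hx
      refine ⟨(h1 hx).congr_deriv ?_, (h2 hx).congr_deriv ?_⟩
      · push_cast; ring
      · simp only [combo]; push_cast; ring
    · simp only [m2, m4, solV_zero]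
      obtain ⟨h1, h2⟩ := heig
      push_cast
      linear_combination h2

theorem combo_ne_zero (hs : IsSymmetricCell ε μ) {E : ℝ} {α β : ℂ} (h : α ≠ 0 ∨ β ≠ 0) :
    combo ε μ E α β ≠ 0 := by
  intro h0
  have hα : α = 0 := by simpa [combo, solU_zero] using congrFun h0 0
  obtain ⟨x, -, hx⟩ := exists_solU_odd_ne_zero hs E
  have h1 := congrFun h0 x
  simp only [combo, hα, zero_mul, zero_add, Pi.zero_apply, mul_eq_zero, Complex.ofReal_eq_zero,
    hx, or_false] at h1
  exact h.elim (fun h => h hα) fun h => h h1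

theorem finiteDimensional_blochSpace (hs : IsSymmetricCell ε μ) (k E : ℝ) :
    FiniteDimensional ℂ (blochSpace ε μ k E) := by
  have hle : blochSpace ε μ k E ≤ Submodule.span ℂ {combo ε μ E 1 0, combo ε μ E 0 1} := by
    intro φ hφ
    obtain ⟨α, β, -, rfl⟩ := (mem_blochSpace_iff hs).1 hφ
    refine Submodule.mem_span_pair.2 ⟨α, β, ?_⟩
    funext x
    simp [combo]
  have : FiniteDimensional ℂ (Submodule.span ℂ {combo ε μ E 1 0, combo ε μ E 0 1}) :=
    FiniteDimensional.span_of_finite ℂ (by simp)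
  exact Submodule.finiteDimensional_of_le hle

/-- The characteristic polynomial of the monodromy matrix at `e^{ik}`. -/
theorem monodromy_det (hs : IsSymmetricCell ε μ) (k E : ℝ) :
    ((halfDisc ε μ E : ℂ) - Complex.exp (Complex.I * k)) ^ 2 -
      (2 * oddVal ε μ E * oddFlux ε μ E) * (2 * evenVal ε μ E * evenFlux ε μ E) =
    2 * Complex.exp (Complex.I * k) * (Real.cos k - halfDisc ε μ E) := by
  have hw : (evenVal ε μ E * oddFlux ε μ E - evenFlux ε μ E * oddVal ε μ E : ℂ) = 1 := by
    exact_mod_cast half_wronskian hs E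
  have hcos : 2 * Complex.exp (Complex.I * k) * Real.cos k =
      Complex.exp (Complex.I * k) ^ 2 + 1 := by
    rw [Complex.ofReal_cos, Complex.cos, mul_comm Complex.I, neg_mul, Complex.exp_neg]
    have := Complex.exp_ne_zero (k * Complex.I)
    field_simp
  rw [mul_sub, hcos, halfDisc]
  push_cast
  linear_combination (evenVal ε μ E * oddFlux ε μ E - evenFlux ε μ E * oddVal ε μ E + 1 : ℂ) * hw

theorem finrank_blochSpace_pos_iff (hs : IsSymmetricCell ε μ) {k E : ℝ} :
    0 < Module.finrank ℂ (blochSpace ε μ k E) ↔ halfDisc ε μ E = Real.cos k := by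
  have := finiteDimensional_blochSpace hs k E
  have hdet := monodromy_det hs k E
  have hexp := Complex.exp_ne_zero (Complex.I * k)
  rw [Module.finrank_pos_iff, Submodule.nontrivial_iff_ne_bot, Submodule.ne_bot_iff]
  constructor
  · rintro ⟨φ, hφ, hne⟩
    obtain ⟨α, β, ⟨h1, h2⟩, rfl⟩ := (mem_blochSpace_iff hs).1 hφ
    have h0 : (2 * Complex.exp (Complex.I * k) * (Real.cos k - halfDisc ε μ E)) = 0 := by
      by_contra hd
      rw [← hdet] at hd
      have hα : α = 0 := by
        refine (mul_eq_zero.1 ?_).resolve_left hd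
        linear_combination ((halfDisc ε μ E : ℂ) - Complex.exp (Complex.I * k)) * h1 -
          (2 * oddVal ε μ E * oddFlux ε μ E : ℂ) * h2
      have hβ : β = 0 := by
        refine (mul_eq_zero.1 ?_).resolve_left hd
        linear_combination ((halfDisc ε μ E : ℂ) - Complex.exp (Complex.I * k)) * h2 -
          (2 * evenVal ε μ E * evenFlux ε μ E : ℂ) * h1
      refine hne (funext fun x => ?_)
      simp [combo, hα, hβ]
    have := (mul_eq_zero.1 h0).resolve_left (mul_ne_zero two_ne_zero hexp)
    exact_mod_cast (sub_eq_zero.1 this).symm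
  · intro hE
    rw [hE, sub_self, mul_zero] at hdet
    have hmem : ∀ α β, IsMonodromyEigen ε μ E (Complex.exp (Complex.I * k)) α β →
        (α ≠ 0 ∨ β ≠ 0) → ∃ x ∈ blochSpace ε μ k E, x ≠ 0 := fun α β h h0 =>
      ⟨_, (mem_blochSpace_iff hs).2 ⟨α, β, h, rfl⟩, combo_ne_zero hs h0⟩
    by_cases hb : (2 * oddVal ε μ E * oddFlux ε μ E : ℂ) = 0
    · by_cases hc : (2 * evenVal ε μ E * evenFlux ε μ E : ℂ) = 0
      · rw [hb, hc, mul_zero, sub_zero, ← hE] at hdet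
        refine hmem 1 0 ⟨?_, ?_⟩ (Or.inl one_ne_zero)
        · rw [mul_zero, add_zero, mul_one]
          exact pow_eq_zero_iff two_ne_zero |>.1 hdet
        · rw [hc]; ring
      · refine hmem (-((halfDisc ε μ E : ℂ) - Complex.exp (Complex.I * k)))
          (2 * evenVal ε μ E * evenFlux ε μ E) ⟨?_, by ring⟩ (Or.inr hc)
        rw [hE]
        linear_combination -hdet
    · refine hmem (2 * oddVal ε μ E * oddFlux ε μ E)
        (-((halfDisc ε μ E : ℂ) - Complex.exp (Complex.I * k))) ⟨by ring, ?_⟩ (Or.inl hb)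
      rw [hE]
      linear_combination -hdet

/-- If the monodromy matrix is upper triangular but not diagonal, with eigenvalue `e^{ik}`, then the
Bloch modes are the multiples of the even solution. -/
theorem blochSpace_of_even (hs : IsSymmetricCell ε μ) {k E : ℝ}
    (hk : (halfDisc ε μ E : ℂ) = Complex.exp (Complex.I * k))
    (h1 : evenVal ε μ E * evenFlux ε μ E = 0) (h2 : oddVal ε μ E * oddFlux ε μ E ≠ 0) :
    Module.finrank ℂ (blochSpace ε μ k E) = 1 ∧ ∀ φ ∈ blochSpace ε μ k E, IsEvenParity φ := by
  have h1' : (2 * evenVal ε μ E * evenFlux ε μ E : ℂ) = 0 := by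
    rw [mul_assoc]; exact_mod_cast by rw [h1, mul_zero]
  have h2' : (2 * oddVal ε μ E * oddFlux ε μ E : ℂ) ≠ 0 := by
    rw [mul_assoc]; exact_mod_cast mul_ne_zero two_ne_zero h2
  have hmem : ∀ φ, φ ∈ blochSpace ε μ k E ↔ ∃ α, φ = combo ε μ E α 0 := by
    intro φ
    rw [mem_blochSpace_iff hs]
    constructor
    · rintro ⟨α, β, ⟨e1, -⟩, rfl⟩
      rw [hk, sub_self, zero_mul, zero_add] at e1
      rw [(mul_eq_zero.1 e1).resolve_left h2']
      exact ⟨α, rfl⟩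
    · rintro ⟨α, rfl⟩
      exact ⟨α, 0, ⟨by rw [hk]; ring, by rw [h1']; ring⟩, rfl⟩
  constructor
  · have hspan : blochSpace ε μ k E = Submodule.span ℂ {combo ε μ E 1 0} := by
      ext φ
      rw [hmem, Submodule.mem_span_singleton]
      refine exists_congr fun α => ?_
      have : combo ε μ E α 0 = α • combo ε μ E 1 0 := by funext x; simp [combo]
      rw [this, eq_comm]
    rw [hspan, finrank_span_singleton (combo_ne_zero hs (Or.inl one_ne_zero))]
  · intro φ hφ
    obtain ⟨α, rfl⟩ := (hmem φ).1 hφ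
    funext x
    simp [parityOp, combo, solU_even hs]

/-- If the monodromy matrix is lower triangular but not diagonal, with eigenvalue `e^{ik}`, then the
Bloch modes are the multiples of the odd solution. -/
theorem blochSpace_of_odd (hs : IsSymmetricCell ε μ) {k E : ℝ}
    (hk : (halfDisc ε μ E : ℂ) = Complex.exp (Complex.I * k))
    (h1 : oddVal ε μ E * oddFlux ε μ E = 0) (h2 : evenVal ε μ E * evenFlux ε μ E ≠ 0) :
    Module.finrank ℂ (blochSpace ε μ k E) = 1 ∧ ∀ φ ∈ blochSpace ε μ k E, IsOddParity φ := by
  have h1' : (2 * oddVal ε μ E * oddFlux ε μ E : ℂ) = 0 := by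
    rw [mul_assoc]; exact_mod_cast by rw [h1, mul_zero]
  have h2' : (2 * evenVal ε μ E * evenFlux ε μ E : ℂ) ≠ 0 := by
    rw [mul_assoc]; exact_mod_cast mul_ne_zero two_ne_zero h2
  have hmem : ∀ φ, φ ∈ blochSpace ε μ k E ↔ ∃ β, φ = combo ε μ E 0 β := by
    intro φ
    rw [mem_blochSpace_iff hs]
    constructor
    · rintro ⟨α, β, ⟨-, e2⟩, rfl⟩
      rw [hk, sub_self, zero_mul, add_zero] at e2
      rw [(mul_eq_zero.1 e2).resolve_left h2']
      exact ⟨β, rfl⟩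
    · rintro ⟨β, rfl⟩
      exact ⟨0, β, ⟨by rw [h1']; ring, by rw [hk]; ring⟩, rfl⟩
  constructor
  · have hspan : blochSpace ε μ k E = Submodule.span ℂ {combo ε μ E 0 1} := by
      ext φ
      rw [hmem, Submodule.mem_span_singleton]
      refine exists_congr fun β => ?_
      have : combo ε μ E 0 β = β • combo ε μ E 0 1 := by funext x; simp [combo]
      rw [this, eq_comm]
    rw [hspan, finrank_span_singleton (combo_ne_zero hs (Or.inr one_ne_zero))]
  · intro φ hφ
    obtain ⟨β, rfl⟩ := (hmem φ).1 hφ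
    funext x
    simp [parityOp, combo, solU_odd hs]

/-! ### Counting eigenvalues -/

theorem nonneg_of_halfDisc_eq_cos (hs : IsSymmetricCell ε μ) {k E : ℝ}
    (hE : halfDisc ε μ E = Real.cos k) : 0 ≤ E := by
  by_contra! h
  have h1 := one_lt_halfDisc_sq_of_neg hs h
  rw [hE] at h1
  exact absurd (Real.cos_sq_le_one k) (not_le.2 h1)

theorem finite_eigenvalues_le (hs : IsSymmetricCell ε μ) (k t : ℝ) :
    {E | E ≤ t ∧ halfDisc ε μ E = Real.cos k}.Finite := by
  by_contra hinf
  obtain ⟨E, -, hacc⟩ := Set.Infinite.exists_accPt_of_subset_isCompact hinf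
    (isCompact_Icc (a := (0 : ℝ)) (b := t))
    fun x hx => ⟨nonneg_of_halfDisc_eq_cos hs hx.2, hx.1⟩
  rw [accPt_iff_frequently_nhdsNE] at hacc
  have hE : halfDisc ε μ E = Real.cos k := by
    have hcl : IsClosed {x | halfDisc ε μ x = Real.cos k} :=
      isClosed_eq (continuous_halfDisc hs) continuous_const
    refine hcl.mem_of_frequently_of_tendsto (hacc.mono fun x hx => hx.2)
      (tendsto_id.mono_left nhdsWithin_le_nhds)
  exact hacc ((eventually_halfDisc_ne hs (Real.abs_cos_le_one k) hE).mono fun x hx hx' => hx hx'.2)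

theorem eigenvalueCount_add_one_le (hs : IsSymmetricCell ε μ) {k t E : ℝ} (ht : t < E)
    (hE : halfDisc ε μ E = Real.cos k) :
    eigenvalueCount ε μ k t + 1 ≤ eigenvalueCount ε μ k E := by
  rw [eigenvalueCount, ← encard_insert_of_notMem (a := (E, 0)) fun h => not_le.2 ht h.1]
  refine encard_le_encard (insert_subset ⟨le_rfl, (finrank_blochSpace_pos_iff hs).2 hE⟩ ?_)
  exact fun p hp => ⟨hp.1.trans ht.le, hp.2⟩

theorem exists_le_eigenvalueCount (hs : IsSymmetricCell ε μ) (j : ℕ) :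
    ∃ T, ∀ k, (j : ℕ∞) ≤ eigenvalueCount ε μ k T := by
  induction j with
  | zero => exact ⟨0, fun k => by simp⟩
  | succ j ih =>
    obtain ⟨T, hT⟩ := ih
    obtain ⟨t, t', h1, h2, h3, h4⟩ := exists_halfDisc_eq_neg_one_eq_one hs T
    refine ⟨t', fun k => ?_⟩
    obtain ⟨E, hE, hEk⟩ := intermediate_value_Icc h2.le (continuous_halfDisc hs).continuousOn
      (show Real.cos k ∈ Icc (halfDisc ε μ t) (halfDisc ε μ t') by
        rw [h3, h4]; exact ⟨Real.neg_one_le_cos k, Real.cos_le_one k⟩)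
    have h5 := eigenvalueCount_add_one_le hs (h1.trans_le hE.1) hEk
    have h6 : eigenvalueCount ε μ k E ≤ eigenvalueCount ε μ k t' :=
      encard_le_encard fun p hp => ⟨hp.1.trans hE.2, hp.2⟩
    push_cast
    exact (add_le_add_left (hT k) 1).trans (h5.trans h6)

/-- The infimum defining `bandEnergy` is attained, at an eigenvalue. -/
theorem bandEnergy_spec (hs : IsSymmetricCell ε μ) {j : ℕ} (hj : 1 ≤ j) (k : ℝ) :
    IsLeast {t | (j : ℕ∞) ≤ eigenvalueCount ε μ k t} (bandEnergy ε μ j k) ∧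
      halfDisc ε μ (bandEnergy ε μ j k) = Real.cos k := by
  -- The count does not change between `t` and the largest eigenvalue below `t`.
  have key : ∀ t, (j : ℕ∞) ≤ eigenvalueCount ε μ k t →
      ∃ z ≤ t, halfDisc ε μ z = Real.cos k ∧ (j : ℕ∞) ≤ eigenvalueCount ε μ k z := by
    intro t ht
    have hne : {E | E ≤ t ∧ halfDisc ε μ E = Real.cos k}.Nonempty := by
      by_contra hempty
      rw [not_nonempty_iff_eq_empty] at hempty
      have h0 : eigenvalueCount ε μ k t = 0 := by
        rw [eigenvalueCount, encard_eq_zero, eq_empty_iff_forall_notMem]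
        rintro p ⟨hp1, hp2⟩
        have : p.1 ∈ {E | E ≤ t ∧ halfDisc ε μ E = Real.cos k} :=
          ⟨hp1, (finrank_blochSpace_pos_iff hs).1 (Nat.zero_lt_of_lt hp2)⟩
        rw [hempty] at this
        exact this
      rw [h0] at ht
      have : j ≤ 0 := by exact_mod_cast ht
      omega
    obtain ⟨z, hz, hmax⟩ := Set.exists_max_image _ id (finite_eigenvalues_le hs k t) hne
    refine ⟨z, hz.1, hz.2, ht.trans (encard_le_encard ?_)⟩
    rintro p ⟨hp1, hp2⟩
    exact ⟨hmax p.1 ⟨hp1, (finrank_blochSpace_pos_iff hs).1 (Nat.zero_lt_of_lt hp2)⟩, hp2⟩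
  obtain ⟨T, hT⟩ := exists_le_eigenvalueCount hs j
  have hfin : {E | E ≤ T ∧ halfDisc ε μ E = Real.cos k ∧
      (j : ℕ∞) ≤ eigenvalueCount ε μ k E}.Finite :=
    (finite_eigenvalues_le hs k T).subset fun E hE => ⟨hE.1, hE.2.1⟩
  obtain ⟨e, he, hmin⟩ := Set.exists_min_image _ id hfin (key T (hT k))
  have hleast : IsLeast {t | (j : ℕ∞) ≤ eigenvalueCount ε μ k t} e := by
    refine ⟨he.2.2, fun t ht => ?_⟩
    rcases le_total t T with htT | htT
    · obtain ⟨z, hz, hz'⟩ := key t ht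
      exact (hmin z ⟨hz.trans htT, hz'⟩).trans hz
    · exact he.1.trans htT
  have heq : bandEnergy ε μ j k = e := hleast.csInf_eq
  rw [heq]
  exact ⟨hleast, he.2.1⟩

theorem bandEnergy_le_bandTop (hs : IsSymmetricCell ε μ) {j : ℕ} (hj : 1 ≤ j) {k : ℝ}
    (hk : k ∈ Icc (-Real.pi) Real.pi) : bandEnergy ε μ j k ≤ bandTop ε μ j := by
  obtain ⟨T, hT⟩ := exists_le_eigenvalueCount hs j
  refine le_csSup ⟨T, ?_⟩ (mem_image_of_mem _ hk)
  rintro _ ⟨k', -, rfl⟩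
  exact (bandEnergy_spec hs hj k').1.2 (hT k')

theorem bandBottom_le_bandEnergy (hs : IsSymmetricCell ε μ) {j : ℕ} (hj : 1 ≤ j) {k : ℝ}
    (hk : k ∈ Icc (-Real.pi) Real.pi) : bandBottom ε μ j ≤ bandEnergy ε μ j k := by
  refine csInf_le ⟨0, ?_⟩ (mem_image_of_mem _ hk)
  rintro _ ⟨k', -, rfl⟩
  exact nonneg_of_halfDisc_eq_cos hs (bandEnergy_spec hs hj k').2

theorem abs_halfDisc_le_one_of_mem_closure (hs : IsSymmetricCell ε μ) {j : ℕ} (hj : 1 ≤ j) {E : ℝ}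
    (hE : E ∈ closure (bandEnergy ε μ j '' Icc (-Real.pi) Real.pi)) : |halfDisc ε μ E| ≤ 1 := by
  have hcl : IsClosed {x | |halfDisc ε μ x| ≤ 1} :=
    isClosed_le (continuous_halfDisc hs).abs continuous_const
  refine closure_minimal ?_ hcl hE
  rintro _ ⟨k, -, rfl⟩
  rw [mem_ofPred_eq, (bandEnergy_spec hs hj k).2]
  exact Real.abs_cos_le_one k

theorem zero_mem_brillouinZone : (0 : ℝ) ∈ Icc (-Real.pi) Real.pi :=
  ⟨neg_nonpos.2 Real.pi_pos.le, Real.pi_pos.le⟩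

theorem abs_halfDisc_bandTop_le_one (hs : IsSymmetricCell ε μ) {j : ℕ} (hj : 1 ≤ j) :
    |halfDisc ε μ (bandTop ε μ j)| ≤ 1 := by
  obtain ⟨T, hT⟩ := exists_le_eigenvalueCount hs j
  refine abs_halfDisc_le_one_of_mem_closure hs hj
    (csSup_mem_closure ⟨_, mem_image_of_mem _ zero_mem_brillouinZone⟩ ⟨T, ?_⟩)
  rintro _ ⟨k', -, rfl⟩
  exact (bandEnergy_spec hs hj k').1.2 (hT k')

theorem abs_halfDisc_bandBottom_le_one (hs : IsSymmetricCell ε μ) {j : ℕ} (hj : 1 ≤ j) :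
    |halfDisc ε μ (bandBottom ε μ j)| ≤ 1 := by
  refine abs_halfDisc_le_one_of_mem_closure hs hj
    (csInf_mem_closure ⟨_, mem_image_of_mem _ zero_mem_brillouinZone⟩ ⟨0, ?_⟩)
  rintro _ ⟨k', -, rfl⟩
  exact nonneg_of_halfDisc_eq_cos hs (bandEnergy_spec hs hj k').2

/-! ### Gaps -/

/-- An eigenvalue below the `(j + 1)`-st band lies in one of the first `j` bands. -/
theorem le_bandEnergy_of_lt_bandBottom (hs : IsSymmetricCell ε μ) {j : ℕ} (hj : 1 ≤ j) {k E : ℝ}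
    (hk : k ∈ Icc (-Real.pi) Real.pi) (hE : halfDisc ε μ E = Real.cos k)
    (hlt : E < bandBottom ε μ (j + 1)) : E ≤ bandEnergy ε μ j k := by
  by_contra! h
  have h1 := eigenvalueCount_add_one_le hs h hE
  have h2 := (bandEnergy_spec hs hj k).1.1
  have h3 : ((j + 1 : ℕ) : ℕ∞) ≤ eigenvalueCount ε μ k E := by
    push_cast
    exact (add_le_add_left h2 1).trans h1
  have h4 := (bandEnergy_spec hs (Nat.le_add_left 1 j) k).1.2 h3
  have h5 := bandBottom_le_bandEnergy hs (Nat.le_add_left 1 j) hk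
  linarith

theorem one_lt_abs_halfDisc_of_mem_gap (hs : IsSymmetricCell ε μ) {j : ℕ} (hj : 1 ≤ j) {E : ℝ}
    (hE : E ∈ Ioo (bandTop ε μ j) (bandBottom ε μ (j + 1))) : 1 < |halfDisc ε μ E| := by
  by_contra! h
  obtain ⟨h1, h2⟩ := abs_le.1 h
  have hk : Real.arccos (halfDisc ε μ E) ∈ Icc (-Real.pi) Real.pi :=
    ⟨by linarith [Real.arccos_nonneg (halfDisc ε μ E), Real.pi_pos], Real.arccos_le_pi _⟩
  have h3 := le_bandEnergy_of_lt_bandBottom hs hj hk (Real.cos_arccos h1 h2).symm hE.2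
  have h4 := bandEnergy_le_bandTop hs hj hk
  exact absurd (h3.trans h4) (not_le.2 hE.1)

/-- At a gap both edges of which are eigenvalues at `k`, these are the band energies at `k`. -/
theorem bandEnergy_eq_edges (hs : IsSymmetricCell ε μ) {j : ℕ} (hj : 1 ≤ j)
    (hgap : bandTop ε μ j < bandBottom ε μ (j + 1)) {k : ℝ} (hk : k ∈ Icc (-Real.pi) Real.pi)
    (h1 : halfDisc ε μ (bandTop ε μ j) = Real.cos k)
    (h2 : halfDisc ε μ (bandBottom ε μ (j + 1)) = Real.cos k) :
    bandEnergy ε μ j k = bandTop ε μ j ∧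
      bandEnergy ε μ (j + 1) k = bandBottom ε μ (j + 1) := by
  have htop := bandEnergy_le_bandTop hs hj hk
  refine ⟨le_antisymm htop (le_bandEnergy_of_lt_bandBottom hs hj hk h1 hgap),
    le_antisymm ?_ (bandBottom_le_bandEnergy hs (Nat.le_add_left 1 j) hk)⟩
  refine (bandEnergy_spec hs (Nat.le_add_left 1 j) k).1.2 ?_
  have h3 := eigenvalueCount_add_one_le hs (htop.trans_lt hgap) h2
  rw [mem_ofPred_eq]
  push_cast
  exact (add_le_add_left (bandEnergy_spec hs hj k).1.1 1).trans h3

theorem one_le_of_one_lt_abs {f : ℝ → ℝ} (hf : Continuous f) {a b : ℝ} (hab : a < b)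
    (h : ∀ x ∈ Ioo a b, 1 < |f x|) {m : ℝ} (hm : m ∈ Ioo a b) (hfm : 1 < f m) :
    (∀ x ∈ Ioo a b, 1 < f x) ∧ ∀ x ∈ Icc a b, 1 ≤ f x := by
  have h1 : ∀ x ∈ Ioo a b, 1 < f x := by
    intro x hx
    by_contra! hle
    obtain ⟨y, hy, hy0⟩ := isPreconnected_Ioo.intermediate_value hx hm hf.continuousOn
      ⟨hle, hfm.le⟩
    have := h y hy
    rw [hy0, abs_one] at this
    exact lt_irrefl _ this
  refine ⟨h1, fun x hx => ?_⟩
  rw [← closure_Ioo hab.ne] at hx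
  exact closure_minimal (fun y hy => (h1 y hy).le) (isClosed_le continuous_const hf) hx

/-- A continuous function of modulus greater than one inside an interval and at most one at its end
points equals the same `±1` at both of them, and keeps its sign inside. -/
theorem exists_sign_of_one_lt_abs {f : ℝ → ℝ} (hf : Continuous f) {a b : ℝ} (hab : a < b)
    (h : ∀ x ∈ Ioo a b, 1 < |f x|) (ha : |f a| ≤ 1) (hb : |f b| ≤ 1) :
    (f a = 1 ∧ f b = 1 ∧ ∀ x ∈ Ioo a b, 1 < f x) ∨
      (f a = -1 ∧ f b = -1 ∧ ∀ x ∈ Ioo a b, f x < -1) := by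
  obtain ⟨m, hm⟩ := nonempty_Ioo.2 hab
  rcases lt_abs.1 (h m hm) with hfm | hfm
  · left
    obtain ⟨h1, h2⟩ := one_le_of_one_lt_abs hf hab h hm hfm
    exact ⟨le_antisymm (abs_le.1 ha).2 (h2 a (left_mem_Icc.2 hab.le)),
      le_antisymm (abs_le.1 hb).2 (h2 b (right_mem_Icc.2 hab.le)), h1⟩
  · right
    obtain ⟨h1, h2⟩ := one_le_of_one_lt_abs hf.neg hab (fun x hx => by simpa using h x hx) hm hfm
    simp only [Pi.neg_apply] at h1 h2
    refine ⟨le_antisymm ?_ (abs_le.1 ha).1, le_antisymm ?_ (abs_le.1 hb).1, fun x hx => ?_⟩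
    · linarith [h2 a (left_mem_Icc.2 hab.le)]
    · linarith [h2 b (right_mem_Icc.2 hab.le)]
    · linarith [h1 x hx]

theorem hasDerivAt_nonneg_of_pos_right {F : ℝ → ℝ} {F' a b : ℝ} (hF : HasDerivAt F F' a)
    (hab : a < b) (h0 : F a = 0) (hpos : ∀ x ∈ Ioo a b, 0 < F x) : 0 ≤ F' := by
  have ht := (hasDerivAt_iff_tendsto_slope.1 hF).mono_left (nhdsGT_le_nhdsNE a)
  refine ge_of_tendsto ht ?_
  filter_upwards [Ioo_mem_nhdsGT hab] with x hx
  rw [slope_def_field, h0, sub_zero]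
  exact div_nonneg (hpos x hx).le (sub_nonneg.2 hx.1.le)

theorem hasDerivAt_nonpos_of_pos_left {F : ℝ → ℝ} {F' a b : ℝ} (hF : HasDerivAt F F' b)
    (hab : a < b) (h0 : F b = 0) (hpos : ∀ x ∈ Ioo a b, 0 < F x) : F' ≤ 0 := by
  have ht := (hasDerivAt_iff_tendsto_slope.1 hF).mono_left (nhdsLT_le_nhdsNE b)
  refine le_of_tendsto ht ?_
  filter_upwards [Ioo_mem_nhdsLT hab] with x hx
  rw [slope_def_field, h0, sub_zero]
  exact div_nonpos_of_nonneg_of_nonpos (hpos x hx).le (sub_nonpos.2 hx.2.le)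

/-- If `f` and `g` vanish at `e`, where `e` is a limit of points of `s` at which `f g > 0`, then
their derivatives at `e` do not have opposite signs. -/
theorem hasDerivAt_mul_nonneg {f g : ℝ → ℝ} {f' g' e : ℝ} {s : Set ℝ} [NeBot (𝓝[s] e)]
    (he : e ∉ s) (hf : HasDerivAt f f' e) (hg : HasDerivAt g g' e) (hf0 : f e = 0) (hg0 : g e = 0)
    (hpos : ∀ x ∈ s, 0 < f x * g x) : 0 ≤ f' * g' := by
  have hle : 𝓝[s] e ≤ 𝓝[≠] e := nhdsWithin_mono e fun x hx => by
    rintro rfl; exact he hx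
  have ht := ((hasDerivAt_iff_tendsto_slope.1 hf).mono_left hle).mul
    ((hasDerivAt_iff_tendsto_slope.1 hg).mono_left hle)
  refine ge_of_tendsto ht ?_
  filter_upwards [self_mem_nhdsWithin] with x hx
  rw [slope_def_field, slope_def_field, hf0, hg0, sub_zero, sub_zero, div_mul_div_comm]
  exact div_nonneg (hpos x hx).le (mul_self_nonneg _)

theorem not_sign_change {F : ℝ → ℝ} (hF : Continuous F) {a b : ℝ} (hab : a < b)
    (hne : ∀ x ∈ Icc a b, F x ≠ 0) (h : F a ≤ 0 ∧ 0 ≤ F b ∨ 0 ≤ F a ∧ F b ≤ 0) : False := by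
  rcases h with ⟨h1, h2⟩ | ⟨h1, h2⟩
  · obtain ⟨x, hx, hx0⟩ := intermediate_value_Icc hab.le hF.continuousOn ⟨h1, h2⟩
    exact hne x hx hx0
  · obtain ⟨x, hx, hx0⟩ := intermediate_value_Icc' hab.le hF.continuousOn ⟨h2, h1⟩
    exact hne x hx hx0

/-- The mechanism behind the change of parity. Let `f g` be positive inside `[a, b]` and vanish at
the end points, let the derivatives of `f` and `g` at their zeros be `-h A` and `l G` with `A, G >
0`, and let `h l > 0` on `[a, b]`. If `f` vanished at both end points, then `f g`, being positive
in between, would have a derivative `≥ 0` at `a` and `≤ 0` at `b`, so that `g h` would change its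
sign, although neither `g` nor `h` has a zero; similarly for `g`. If both vanished at one end
point, then `f g` would be negative next to it. -/
theorem zeros_alternate {f g h l : ℝ → ℝ} (hf : Continuous f) (hg : Continuous g)
    (hh : Continuous h) (hl : Continuous l) {a b : ℝ} (hab : a < b)
    (hderiv : ∀ E, ∃ A B G : ℝ, 0 < A ∧ 0 < G ∧ HasDerivAt f (f E * B - h E * A) E ∧
      HasDerivAt g (l E * G - g E * B) E)
    (hhl : ∀ E ∈ Icc a b, 0 < h E * l E) (hpos : ∀ E ∈ Ioo a b, 0 < f E * g E)
    (ha : f a * g a = 0) (hb : f b * g b = 0) :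
    (f a = 0 ∧ g a ≠ 0 ∧ f b ≠ 0 ∧ g b = 0) ∨ (f a ≠ 0 ∧ g a = 0 ∧ f b = 0 ∧ g b ≠ 0) := by
  have hb1 : NeBot (𝓝[Ioo a b] a) := by
    rw [nhdsWithin_Ioo_eq_nhdsGT hab]; infer_instance
  have hb2 : NeBot (𝓝[Ioo a b] b) := by
    rw [nhdsWithin_Ioo_eq_nhdsLT hab]; infer_instance
  have hma : a ∈ Icc a b := left_mem_Icc.2 hab.le
  have hmb : b ∈ Icc a b := right_mem_Icc.2 hab.le
  have hnot : ∀ e ∈ Icc a b, e ∉ Ioo a b → NeBot (𝓝[Ioo a b] e) → ¬ (f e = 0 ∧ g e = 0) := by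
    rintro e he he' hne ⟨h1, h2⟩
    obtain ⟨A, B, G, hA, hG, hf', hg'⟩ := hderiv e
    have := hasDerivAt_mul_nonneg he' hf' hg' h1 h2 hpos
    simp only [h1, h2, zero_mul, zero_sub, sub_zero] at this
    have h3 := mul_pos (hhl e he) (mul_pos hA hG)
    linarith
  have hna := hnot a hma (fun h => lt_irrefl _ h.1) hb1
  have hnb := hnot b hmb (fun h => lt_irrefl _ h.2) hb2
  obtain ⟨A, B, G, hA, hG, hfa, hga⟩ := hderiv a
  obtain ⟨A', B', G', hA', hG', hfb, hgb⟩ := hderiv b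
  have hda := hasDerivAt_nonneg_of_pos_right (hfa.mul hga) hab ha hpos
  have hdb := hasDerivAt_nonpos_of_pos_left (hfb.mul hgb) hab hb hpos
  have hh0 : ∀ E ∈ Icc a b, h E ≠ 0 := fun E hE => left_ne_zero_of_mul (hhl E hE).ne'
  have hl0 : ∀ E ∈ Icc a b, l E ≠ 0 := fun E hE => right_ne_zero_of_mul (hhl E hE).ne'
  have hin : ∀ E ∈ Icc a b, E = a ∨ E = b ∨ E ∈ Ioo a b := by
    intro E hE
    rcases hE.1.eq_or_lt with h1 | h1
    · exact Or.inl h1.symm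
    · rcases hE.2.eq_or_lt with h2 | h2
      · exact Or.inr (Or.inl h2)
      · exact Or.inr (Or.inr ⟨h1, h2⟩)
  rcases mul_eq_zero.1 ha with fa | ga
  · have ga : g a ≠ 0 := fun h => hna ⟨fa, h⟩
    rcases mul_eq_zero.1 hb with fb | gb
    · exfalso
      have gb : g b ≠ 0 := fun h => hnb ⟨fb, h⟩
      refine not_sign_change (hg.mul hh) hab (fun E hE => mul_ne_zero ?_ (hh0 E hE)) (Or.inl ?_)
      · rcases hin E hE with rfl | rfl | hE
        · exact ga
        · exact gb
        · exact right_ne_zero_of_mul (hpos E hE).ne'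
      · rw [fa] at hda
        rw [fb] at hdb
        simp only [Pi.mul_apply]
        constructor
        · by_contra! hc
          nlinarith [mul_pos hc hA]
        · by_contra! hc
          nlinarith [mul_neg_of_neg_of_pos hc hA']
    · exact Or.inl ⟨fa, ga, fun h => hnb ⟨h, gb⟩, gb⟩
  · have fa : f a ≠ 0 := fun h => hna ⟨h, ga⟩
    rcases mul_eq_zero.1 hb with fb | gb
    · exact Or.inr ⟨fa, ga, fb, fun h => hnb ⟨fb, h⟩⟩
    · exfalso
      have fb : f b ≠ 0 := fun h => hnb ⟨h, gb⟩
      refine not_sign_change (hf.mul hl) hab (fun E hE => mul_ne_zero ?_ (hl0 E hE)) (Or.inr ?_)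
      · rcases hin E hE with rfl | rfl | hE
        · exact fa
        · exact fb
        · exact left_ne_zero_of_mul (hpos E hE).ne'
      · rw [ga] at hda
        rw [gb] at hdb
        simp only [Pi.mul_apply]
        constructor
        · by_contra! hc
          nlinarith [mul_neg_of_neg_of_pos hc hG]
        · by_contra! hc
          nlinarith [mul_pos hc hG']

/-- The parity alternative at the two edges of a gap, at the quasi-momentum `k` of the edges. -/
def ParityChange (ε μ : ℝ → ℝ) (k a b : ℝ) : Prop :=
  Module.finrank ℂ (blochSpace ε μ k a) = 1 ∧ Module.finrank ℂ (blochSpace ε μ k b) = 1 ∧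
    (((∀ φ ∈ blochSpace ε μ k a, IsEvenParity φ) ∧ ∀ φ ∈ blochSpace ε μ k b, IsOddParity φ) ∨
      ((∀ φ ∈ blochSpace ε μ k a, IsOddParity φ) ∧ ∀ φ ∈ blochSpace ε μ k b, IsEvenParity φ))

/-- A gap with periodic edges: the edges are zeros of `evenFlux * oddVal`. -/
theorem parityChange_zero (hs : IsSymmetricCell ε μ) {a b : ℝ} (hab : a < b)
    (ha : halfDisc ε μ a = 1) (hb : halfDisc ε μ b = 1)
    (hgap : ∀ E ∈ Ioo a b, 1 < halfDisc ε μ E) : ParityChange ε μ 0 a b := by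
  obtain ⟨cp, cq, cr, cw⟩ := continuous_half hs
  have hw := half_wronskian hs
  simp only [halfDisc] at ha hb hgap
  have hge : ∀ E ∈ Icc a b, 0 ≤ evenFlux ε μ E * oddVal ε μ E := by
    intro E hE
    rcases hE.1.eq_or_lt with rfl | h1
    · linarith [hw a]
    · rcases hE.2.eq_or_lt with rfl | h2
      · linarith [hw E]
      · linarith [hw E, hgap E ⟨h1, h2⟩]
  have hne : ∀ E ∈ Icc a b, 0 < oddFlux ε μ E * evenVal ε μ E := fun E hE => by
    linarith [hw E, hge E hE]
  have halt := zeros_alternate cq cr cw cp hab (fun E => by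
      obtain ⟨A, B, G, hA, hG, -, hq, hr, -⟩ := exists_hasDerivAt_half hs E
      exact ⟨A, B, G, hA, hG, hq, hr⟩) hne
    (fun E hE => by linarith [hw E, hgap E hE]) (by linarith [hw a]) (by linarith [hw b])
  have hexp : ∀ E, halfDisc ε μ E = 1 → (halfDisc ε μ E : ℂ) = Complex.exp (Complex.I * (0 : ℝ)) :=
    fun E h => by simp [h]
  have hev : ∀ E ∈ Icc a b, halfDisc ε μ E = 1 → evenFlux ε μ E = 0 → oddVal ε μ E ≠ 0 → _ :=
    fun E hE h1 h2 h3 => blochSpace_of_even hs (hexp E h1) (by rw [h2, mul_zero])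
      (mul_ne_zero h3 (left_ne_zero_of_mul (hne E hE).ne'))
  have hod : ∀ E ∈ Icc a b, halfDisc ε μ E = 1 → evenFlux ε μ E ≠ 0 → oddVal ε μ E = 0 → _ :=
    fun E hE h1 h2 h3 => blochSpace_of_odd hs (hexp E h1) (by rw [h3, zero_mul])
      (mul_ne_zero (right_ne_zero_of_mul (hne E hE).ne') h2)
  have hma : a ∈ Icc a b := left_mem_Icc.2 hab.le
  have hmb : b ∈ Icc a b := right_mem_Icc.2 hab.le
  rcases halt with ⟨h1, h2, h3, h4⟩ | ⟨h1, h2, h3, h4⟩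
  · have e1 := hev a hma ha h1 h2
    have e2 := hod b hmb hb h3 h4
    exact ⟨e1.1, e2.1, Or.inl ⟨e1.2, e2.2⟩⟩
  · have e1 := hod a hma ha h1 h2
    have e2 := hev b hmb hb h3 h4
    exact ⟨e1.1, e2.1, Or.inr ⟨e1.2, e2.2⟩⟩

/-- A gap with antiperiodic edges: the edges are zeros of `evenVal * oddFlux`. -/
theorem parityChange_pi (hs : IsSymmetricCell ε μ) {a b : ℝ} (hab : a < b)
    (ha : halfDisc ε μ a = -1) (hb : halfDisc ε μ b = -1)
    (hgap : ∀ E ∈ Ioo a b, halfDisc ε μ E < -1) : ParityChange ε μ Real.pi a b := by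
  obtain ⟨cp, cq, cr, cw⟩ := continuous_half hs
  have hw := half_wronskian hs
  simp only [halfDisc] at ha hb hgap
  have hge : ∀ E ∈ Icc a b, evenVal ε μ E * oddFlux ε μ E ≤ 0 := by
    intro E hE
    rcases hE.1.eq_or_lt with rfl | h1
    · linarith [hw a]
    · rcases hE.2.eq_or_lt with rfl | h2
      · linarith [hw E]
      · linarith [hw E, hgap E ⟨h1, h2⟩]
  have hne : ∀ E ∈ Icc a b, 0 < oddVal ε μ E * -evenFlux ε μ E := fun E hE => by
    linarith [hw E, hge E hE]
  have halt := zeros_alternate cp cw.neg cr cq.neg hab (fun E => by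
      obtain ⟨A, B, G, hA, hG, hp, -, -, hw'⟩ := exists_hasDerivAt_half hs E
      exact ⟨A, B, G, hA, hG, hp, hw'.neg.congr_deriv (by simp only [Pi.neg_apply]; ring)⟩) hne
    (fun E hE => by simp only [Pi.neg_apply]; linarith [hw E, hgap E hE])
    (by simp only [Pi.neg_apply]; linarith [hw a]) (by simp only [Pi.neg_apply]; linarith [hw b])
  simp only [Pi.neg_apply, neg_eq_zero, ne_eq] at halt
  have hexp : ∀ E, halfDisc ε μ E = -1 → (halfDisc ε μ E : ℂ) = Complex.exp (Complex.I * Real.pi) :=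
    fun E h => by rw [h, mul_comm, Complex.exp_pi_mul_I]; simp
  have hev : ∀ E ∈ Icc a b, halfDisc ε μ E = -1 → evenVal ε μ E = 0 → oddFlux ε μ E ≠ 0 → _ :=
    fun E hE h1 h2 h3 => blochSpace_of_even hs (hexp E h1) (by rw [h2, zero_mul])
      (mul_ne_zero (left_ne_zero_of_mul (hne E hE).ne') h3)
  have hod : ∀ E ∈ Icc a b, halfDisc ε μ E = -1 → evenVal ε μ E ≠ 0 → oddFlux ε μ E = 0 → _ :=
    fun E hE h1 h2 h3 => blochSpace_of_odd hs (hexp E h1) (by rw [h3, mul_zero])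
      (mul_ne_zero h2 (neg_ne_zero.1 (right_ne_zero_of_mul (hne E hE).ne')))
  have hma : a ∈ Icc a b := left_mem_Icc.2 hab.le
  have hmb : b ∈ Icc a b := right_mem_Icc.2 hab.le
  rcases halt with ⟨h1, h2, h3, h4⟩ | ⟨h1, h2, h3, h4⟩
  · have e1 := hev a hma ha h1 h2
    have e2 := hod b hmb hb h3 h4
    exact ⟨e1.1, e2.1, Or.inl ⟨e1.2, e2.2⟩⟩
  · have e1 := hod a hma ha h1 h2
    have e2 := hev b hmb hb h3 h4
    exact ⟨e1.1, e2.1, Or.inr ⟨e1.2, e2.2⟩⟩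

end Photonic

end

theorem mainTheorem6 (ε μ : ℝ → ℝ) (h : Photonic.IsPhotonic ε μ) (j : ℕ) (hj : 1 ≤ j)
    (hgap : Photonic.bandTop ε μ j < Photonic.bandBottom ε μ (j + 1)) :
    (∃ k : ℝ, (k = 0 ∨ k = Real.pi) ∧
      Photonic.bandEnergy ε μ j k = Photonic.bandTop ε μ j ∧
      Photonic.bandEnergy ε μ (j + 1) k = Photonic.bandBottom ε μ (j + 1)) ∧
    ∀ k : ℝ, (k = 0 ∨ k = Real.pi) →
      Photonic.bandEnergy ε μ j k = Photonic.bandTop ε μ j →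
      Photonic.bandEnergy ε μ (j + 1) k = Photonic.bandBottom ε μ (j + 1) →
      Module.finrank ℂ (Photonic.blochSpace ε μ k (Photonic.bandTop ε μ j)) = 1 ∧
      Module.finrank ℂ (Photonic.blochSpace ε μ k (Photonic.bandBottom ε μ (j + 1))) = 1 ∧
      (((∀ φ ∈ Photonic.blochSpace ε μ k (Photonic.bandTop ε μ j),
            Photonic.IsEvenParity φ) ∧
          ∀ φ ∈ Photonic.blochSpace ε μ k (Photonic.bandBottom ε μ (j + 1)),
            Photonic.IsOddParity φ) ∨
        ((∀ φ ∈ Photonic.blochSpace ε μ k (Photonic.bandTop ε μ j),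
            Photonic.IsOddParity φ) ∧
          ∀ φ ∈ Photonic.blochSpace ε μ k (Photonic.bandBottom ε μ (j + 1)),
            Photonic.IsEvenParity φ)) := by
  have hs := h.isSymmetricCell
  have hj' : 1 ≤ j + 1 := Nat.le_add_left 1 j
  have hpi := Real.pi_pos
  have hsign := Photonic.exists_sign_of_one_lt_abs (Photonic.continuous_halfDisc hs) hgap
    (fun E hE => Photonic.one_lt_abs_halfDisc_of_mem_gap hs hj hE)
    (Photonic.abs_halfDisc_bandTop_le_one hs hj) (Photonic.abs_halfDisc_bandBottom_le_one hs hj')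
  rcases hsign with ⟨ha, hb, hin⟩ | ⟨ha, hb, hin⟩
  · refine ⟨⟨0, Or.inl rfl, Photonic.bandEnergy_eq_edges hs hj hgap Photonic.zero_mem_brillouinZone
      (by rw [ha, Real.cos_zero]) (by rw [hb, Real.cos_zero])⟩, fun k hk h1 _ => ?_⟩
    rcases hk with rfl | rfl
    · exact Photonic.parityChange_zero hs hgap ha hb hin
    · have := (Photonic.bandEnergy_spec hs hj Real.pi).2
      rw [h1, ha, Real.cos_pi] at this
      norm_num at this
  · refine ⟨⟨Real.pi, Or.inr rfl, Photonic.bandEnergy_eq_edges hs hj hgap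
      ⟨by linarith, le_rfl⟩ (by rw [ha, Real.cos_pi]) (by rw [hb, Real.cos_pi])⟩,
      fun k hk h1 _ => ?_⟩
    rcases hk with rfl | rfl
    · have := (Photonic.bandEnergy_spec hs hj 0).2
      rw [h1, ha, Real.cos_zero] at this
      norm_num at this
    · exact Photonic.parityChange_pi hs hgap ha hb hin
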